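/- Let $G$ be a finite graph (loops and multiple edges allowed, each edge $e$ having a source and a target) with topological realization $|G|$. A spatial graph of type $G$ is a piecewise-linear (PL) embedding $\Gamma\colon |G|\hookrightarrow\mathbb R^3$; two spatial graphs $\Gamma_1,\Gamma_2$ of type $G$ are isotopic if there is a PL isotopy of $\mathbb R^3$ from $\mathrm{id}$ to a homeomorphism $\Phi$ with $\Phi\circ\Gamma_1=\Gamma_2$. If $\pi\colon\mathbb R^3\to\mathbb R^2$ is the standard projection and $\pi\circ\Gamma'$ is injective except for finitely many transverse double points (crossings) between interior points of edges, then the diagram of $\Gamma'$ consists of the projected vertices and oriented edges, together with the over/under information at each crossing. A diagram of $\Gamma$ means the diagram of a spatial graph $\Gamma'$ isotopic to $\Gamma$. A cycle in $G$ is a sub-graph consisting of $k\ge 1$ distinct vertices $v_1,\dots,v_k$ and $k$ distinct edges $e_1,\dots,e_k$ such that, for each $i\in\mathbb Z/k$, the edge $e_i$ has endpoints $v_i$ and $v_{i+1}$. For a cycle $c$, a diagram $D$ restricts to a knot diagram $D_c$, whose writhe $w(D_c)$ is the number of its positive crossings minus the number of its negative crossings, with respect to either orientation of $c$. For a set $C$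 of cycles in $G$, put $w_C(D)=(w(D_c))_{c\in C}\in\mathbb Z^C$, and let $C^*\colon\mathbb Z^{\mathrm E(G)}\to\mathbb Z^C$ be the homomorphism that sends an edge $e$ to $\sum_{c\in C,\ c\ni e}c$. **Corollary (Realizing tuples).** Let $D$ be a diagram of a spatial graph $\Gamma$ of type $G$, let $C$ be a set of cycles in $G$, and let $w\in w_C(D)+C^*(\mathbb Z^{\mathrm E(G)})$. Then $\Gamma$ has a diagram $D'$ with $w_C(D')=w$. -/

import Mathlib

open Set Filter Topology

noncomputable section

/-! ### Graphs, their topological realizations, and cycles -/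

/-- A graph on the vertex set `V` with edge set `E`: loops and multiple edges are allowed, and each
edge has a source and a target. -/
structure EdgeGraph (V E : Type*) where
  src : E → V
  tgt : E → V

namespace EdgeGraph

variable {V E : Type*}

/-- The gluing relation that defines the topological realization: the endpoint `0` of the interval
of `e` is glued to the source of `e`, the endpoint `1` to its target. -/
inductive Glue (G : EdgeGraph V E) : V ⊕ (E × unitInterval) → V ⊕ (E × unitInterval) → Prop
  | src (e : E) : Glue G (Sum.inl (G.src e)) (Sum.inr (e, 0))
  | tgt (e : E) : Glue G (Sum.inl (G.tgt e)) (Sum.inr (e, 1))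

/-- The topological realization `|G|`, as a set of points: the quotient of the disjoint union of `V`
and of one copy of `[0,1]` for each edge by the gluing of endpoints. -/
def Realization (G : EdgeGraph V E) : Type _ := Quot G.Glue

/-- The point of `|G|` with parameter `t ∈ [0,1]` on the edge `e` (parameters outside `[0,1]` are
moved to the nearest endpoint; they play no role). -/
def point (G : EdgeGraph V E) (e : E) (t : ℝ) : G.Realization :=
  Quot.mk _ (Sum.inr (e, Set.projIcc (0 : ℝ) 1 zero_le_one t))

/-- A cyclic enumeration `v₁, e₁, v₂, e₂, …, vₖ, eₖ` (with `k ≥ 1`) of distinct vertices and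
distinct edges such that the endpoints of `eᵢ` are `vᵢ` and `vᵢ₊₁`, indices being in `ℤ/k`. -/
structure Traversal (G : EdgeGraph V E) where
  length : ℕ
  length_pos : 1 ≤ length
  vertex : ZMod length → V
  edge : ZMod length → E
  vertex_injective : Function.Injective vertex
  edge_injective : Function.Injective edge
  endpoints : ∀ i, s(G.src (edge i), G.tgt (edge i)) = s(vertex i, vertex (i + 1))

open Classical in
/-- The direction, `1` or `-1`, in which a traversal runs through one of its edges `e`: it is `1` if
the edge `e = eᵢ` has source `vᵢ` (so it runs from `vᵢ` to `vᵢ₊₁`), and `-1` otherwise. A loop is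
run through in its own direction. -/
def Traversal.direction {G : EdgeGraph V E} (T : G.Traversal) (e : E) : ℝ :=
  if ∃ i, T.edge i = e ∧ G.src e = T.vertex i then 1 else -1

/-- A cycle of `G`: a sub-graph that consists of the vertices and edges of some traversal.
The traversal is not part of the structure. -/
@[ext]
structure Cycle (G : EdgeGraph V E) where
  verts : Set V
  edges : Set E
  exists_traversal : ∃ T : G.Traversal, range T.vertex = verts ∧ range T.edge = edges

/-- A traversal of the cycle `c`, which serves as a choice of an orientation of `c`. -/
def Cycle.traversal {G : EdgeGraph V E} (c : G.Cycle) : G.Traversal :=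
  c.exists_traversal.choose

open Classical in
/-- The homomorphism `C* : ℤ^E → ℤ^C`, which sends the basis element `e` to the sum of the basis
elements `c ∈ C` such that `c` contains `e`. -/
def cycleMap [Fintype E] (G : EdgeGraph V E) (C : Set G.Cycle) : (E → ℤ) →ₗ[ℤ] (C → ℤ) :=
  Fintype.linearCombination ℤ (fun (e : E) (c : C) => if e ∈ c.1.edges then (1 : ℤ) else 0)

end EdgeGraph

/-! ### Piecewise-linear maps and isotopies -/

/-- `f` is piecewise linear (PL) on `P`: it is continuous, and each point `a ∈ P` has a
neighbourhood on which `f` respects the conical structure with apex `a`, that is,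
`f (λ a + μ x) = λ f(a) + μ f(x)` for `λ, μ ≥ 0`, `λ + μ = 1`. (This is used only for polyhedra `P`
that are convex, so that `λ a + μ x` lies in `P` again.) -/
def IsPLOn {X Y : Type*} [AddCommGroup X] [Module ℝ X] [TopologicalSpace X]
    [AddCommGroup Y] [Module ℝ Y] [TopologicalSpace Y] (f : X → Y) (P : Set X) : Prop :=
  ContinuousOn f P ∧ ∀ a ∈ P, ∃ U ∈ 𝓝 a, ∀ x ∈ U ∩ P, ∀ μ ∈ Icc (0 : ℝ) 1,
    f ((1 - μ) • a + μ • x) = (1 - μ) • f a + μ • f x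

/-- The space `ℝ³` (only its topology and its linear structure are used). -/
abbrev Space3 : Type := Fin 3 → ℝ

/-- The plane `ℝ²`. -/
abbrev Plane2 : Type := Fin 2 → ℝ

/-- The standard projection `π : ℝ³ → ℝ²`. -/
def planeProj (x : Space3) : Plane2 := ![x 0, x 1]

/-- A PL isotopy of `ℝ³` that starts at the identity: a level-preserving PL homeomorphism
`(x, t) ↦ (h_t(x), t)` of `ℝ³ × [0,1]` with `h_0 = id`. -/
structure PLIsotopy where
  toFun : ℝ → Space3 → Space3
  inv : ℝ → Space3 → Space3
  isPLOn_toFun : IsPLOn (fun p : Space3 × ℝ => toFun p.2 p.1) (univ ×ˢ Icc (0 : ℝ) 1)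
  isPLOn_inv : IsPLOn (fun p : Space3 × ℝ => inv p.2 p.1) (univ ×ˢ Icc (0 : ℝ) 1)
  left_inv : ∀ t ∈ Icc (0 : ℝ) 1, Function.LeftInverse (inv t) (toFun t)
  right_inv : ∀ t ∈ Icc (0 : ℝ) 1, Function.RightInverse (inv t) (toFun t)
  zero : ∀ x, toFun 0 x = x

/-! ### Crossings in the plane -/

/-- The determinant of two vectors of the plane. -/
def planeDet (a b : Plane2) : ℝ := a 0 * b 1 - a 1 * b 0

/-- The rays spanned by `a`, `b`, `c` are distinct and occur in this cyclic order when one turns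
counterclockwise around the origin. (Of the three angles from `a` to `b`, from `b` to `c` and from
`c` to `a`, which add up to a full turn in this case, at least two are less than a half turn. For
rays that are not in this cyclic order, at most one of the determinants is positive.) -/
def CounterClockwise (a b c : Plane2) : Prop :=
  (0 < planeDet a b ∧ 0 < planeDet b c) ∨ (0 < planeDet b c ∧ 0 < planeDet c a) ∨
    (0 < planeDet c a ∧ 0 < planeDet a b)

/-- Two parametrized strands through the origin at time `0` cross there, and the crossing is
positive if `o` is the over-strand and `u` the under-strand: counterclockwise one meets the outgoing
ray of `o`, the outgoing ray of `u`, the incoming ray of `o`, the incoming ray of `u`.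
The strands may have a corner at the crossing. -/
def IsPositiveCrossing (o u : ℝ → Plane2) : Prop :=
  ∀ᶠ τ in 𝓝[>] (0 : ℝ),
    CounterClockwise (o τ) (u τ) (o (-τ)) ∧ CounterClockwise (o (-τ)) (u (-τ)) (o τ)

/-- As for a positive crossing, with the direction of `u` reversed. -/
def IsNegativeCrossing (o u : ℝ → Plane2) : Prop :=
  IsPositiveCrossing o (fun τ => u (-τ))

open Classical in
/-- The sign of a crossing of the oriented over-strand `o` and the oriented under-strand `u`. -/
def crossingSign (o u : ℝ → Plane2) : ℤ :=
  if IsPositiveCrossing o u then 1 else if IsNegativeCrossing o u then -1 else 0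

/-! ### Spatial graphs and diagrams -/

variable {V E : Type*}

/-- The germ at the point with parameter `a` on the edge `e` of the image of `e` under
`f : |G| → ℝ²`, translated to the origin. It follows the orientation of `e` if `δ = 1` and the
opposite orientation if `δ = -1`. -/
def edgeStrand {G : EdgeGraph V E} (f : G.Realization → Plane2) (e : E) (a δ : ℝ) : ℝ → Plane2 :=
  fun τ => f (G.point e (a + δ * τ)) - f (G.point e a)

/-- `f : |G| → ℝ²` is injective except for finitely many transverse double points between interior
points of edges. -/
structure IsRegularProjection (G : EdgeGraph V E) (f : G.Realization → Plane2) : Prop where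
  finite : {p : G.Realization × G.Realization | p.1 ≠ p.2 ∧ f p.1 = f p.2}.Finite
  interior : ∀ x y, x ≠ y → f x = f y → ∃ e, ∃ a ∈ Ioo (0 : ℝ) 1, x = G.point e a
  double : ∀ x y z, f x = f y → f y = f z → x = y ∨ y = z ∨ x = z
  transverse : ∀ e, ∀ a ∈ Ioo (0 : ℝ) 1, ∀ e', ∀ a' ∈ Ioo (0 : ℝ) 1,
    G.point e a ≠ G.point e' a' → f (G.point e a) = f (G.point e' a') →
    IsPositiveCrossing (edgeStrand f e a 1) (edgeStrand f e' a' 1) ∨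
      IsNegativeCrossing (edgeStrand f e a 1) (edgeStrand f e' a' 1)

/-- A spatial graph of type `G`: a PL embedding of `|G|` in `ℝ³`. A map is PL on `|G|` if it is PL
on each edge. For finite `G`, such an injective map is an embedding, since `|G|` is compact. -/
structure SpatialGraph (G : EdgeGraph V E) where
  toFun : G.Realization → Space3
  isPLOn : ∀ e, IsPLOn (fun t : ℝ => toFun (G.point e t)) (Icc (0 : ℝ) 1)
  injective : Function.Injective toFun

/-- Spatial graphs are isotopic if a PL isotopy of `ℝ³` from the identity to some `Φ` satisfies
`Φ ∘ Γ₁ = Γ₂`. -/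
def SpatialGraph.Isotopic {G : EdgeGraph V E} (Γ₁ Γ₂ : SpatialGraph G) : Prop :=
  ∃ h : PLIsotopy, ∀ x, h.toFun 1 (Γ₁.toFun x) = Γ₂.toFun x

/-- A diagram of type `G`: a regular PL map of `|G|` to the plane (hence the images of the vertices
and the oriented images of the edges) and, at each crossing, the information which strand is the
over-strand: `isOver x y` says that `x ≠ y` are mapped to the same crossing and that the strand
through `x` crosses over the strand through `y`. -/
structure GraphDiagram (G : EdgeGraph V E) where
  toFun : G.Realization → Plane2
  isPLOn : ∀ e, IsPLOn (fun t : ℝ => toFun (G.point e t)) (Icc (0 : ℝ) 1)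
  regular : IsRegularProjection G toFun
  isOver : G.Realization → G.Realization → Prop
  crossing_of_isOver : ∀ x y, isOver x y → x ≠ y ∧ toFun x = toFun y
  isOver_or_isOver : ∀ x y, x ≠ y → toFun x = toFun y → isOver x y ∨ isOver y x
  isOver_asymm : ∀ x y, isOver x y → ¬ isOver y x

theorem IsPLOn.planeProj_comp {f : ℝ → Space3} {P : Set ℝ} (hf : IsPLOn f P) :
    IsPLOn (fun t => planeProj (f t)) P := by
  have hc : Continuous planeProj := by
    refine continuous_pi fun i => ?_
    fin_cases i
    · exact continuous_apply 0
    · exact continuous_apply 1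
  refine ⟨hc.comp_continuousOn hf.1, fun a ha => ?_⟩
  obtain ⟨U, hU, h⟩ := hf.2 a ha
  refine ⟨U, hU, fun x hx μ hμ => ?_⟩
  simp only [h x hx μ hμ]
  ext i
  fin_cases i <;> simp [planeProj]

namespace SpatialGraph

variable {G : EdgeGraph V E}

/-- `Γ` has a diagram: `π ∘ Γ` is injective except for finitely many transverse double points
between interior points of edges. -/
def HasDiagram (Γ : SpatialGraph G) : Prop :=
  IsRegularProjection G (fun x => planeProj (Γ.toFun x))

/-- The diagram of a spatial graph `Γ` that has a diagram: the projection `π ∘ Γ`, the over-strand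
at a crossing being the one whose third coordinate is larger. -/
def diagram (Γ : SpatialGraph G) (h : Γ.HasDiagram) : GraphDiagram G where
  toFun x := planeProj (Γ.toFun x)
  isPLOn e := (Γ.isPLOn e).planeProj_comp
  regular := h
  isOver x y := planeProj (Γ.toFun x) = planeProj (Γ.toFun y) ∧ Γ.toFun y 2 < Γ.toFun x 2
  crossing_of_isOver x y hxy := ⟨fun e => by simp [e] at hxy, hxy.1⟩
  isOver_or_isOver x y hne hxy := by
    have h2 : Γ.toFun x 2 ≠ Γ.toFun y 2 := fun h2 => hne <| Γ.injective <| by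
      ext i
      fin_cases i
      · exact congrFun hxy 0
      · exact congrFun hxy 1
      · exact h2
    rcases lt_or_gt_of_ne h2 with hlt | hlt
    · exact Or.inr ⟨hxy.symm, hlt⟩
    · exact Or.inl ⟨hxy, hlt⟩
  isOver_asymm x y hxy hyx := lt_asymm hxy.2 hyx.2

end SpatialGraph

namespace GraphDiagram

variable {G : EdgeGraph V E}

/-- `D` is a diagram of `Γ`: it is the diagram of a spatial graph isotopic to `Γ`. -/
def IsDiagramOf (D : GraphDiagram G) (Γ : SpatialGraph G) : Prop :=
  ∃ Γ' : SpatialGraph G, Γ.Isotopic Γ' ∧ ∃ h : Γ'.HasDiagram, Γ'.diagram h = D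

/-- The crossings of the knot diagram `D_c` that `D` induces for the cycle `c`. A crossing is given
by the edge and the parameter of the over-strand, and the edge and the parameter of the
under-strand. -/
def cycleCrossings (D : GraphDiagram G) (c : G.Cycle) : Set ((E × ℝ) × (E × ℝ)) :=
  {p | p.1.1 ∈ c.edges ∧ p.1.2 ∈ Ioo (0 : ℝ) 1 ∧ p.2.1 ∈ c.edges ∧ p.2.2 ∈ Ioo (0 : ℝ) 1 ∧
    D.isOver (G.point p.1.1 p.1.2) (G.point p.2.1 p.2.2)}

/-- The writhe `w(D_c)` of the knot diagram `D_c`: the sum (over a finite set) of the signs of its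
crossings, read off with respect to an orientation of `c`. -/
def writhe (D : GraphDiagram G) (c : G.Cycle) : ℤ :=
  ∑ᶠ p ∈ D.cycleCrossings c,
    crossingSign (edgeStrand D.toFun p.1.1 p.1.2 (c.traversal.direction p.1.1))
      (edgeStrand D.toFun p.2.1 p.2.2 (c.traversal.direction p.2.1))

/-- The writhe tuple `w_C(D) = (w(D_c))_{c ∈ C}`. -/
def writheTuple (D : GraphDiagram G) (C : Set G.Cycle) : C → ℤ :=
  fun c => D.writhe c.1

end GraphDiagram

end

/-!
The tuples of writhes of the diagrams of `Γ` are changed by Reidemeister moves of the first kind. A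
kink in the edge `e` adds one crossing of `e` with itself to the diagram. This crossing belongs to
`D_c` exactly for the cycles `c` that contain `e`, and since reversing both strands preserves the
sign of a crossing, it contributes the same sign `± 1`, of our choice, to all of them. So a kink
adds `± C*(e)` to the tuple (`GraphDiagram.IsDiagramOf.exists_kink`), and `C*(ℤ^E)` is generated by
these vectors.

The work lies in realizing the kink by a PL isotopy of `ℝ³`.

* The isotopies used are shears `x ↦ x + clamp (t M) (φ x) • v`, where `φ` is PL, bounded by `M`,
  and of slope at most `1 / 2` in the direction `v`. Truncating `φ` at the level `t M`, instead of
  multiplying it by `t`, makes the shear PL jointly in `x` and `t`. On each line of direction `v`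
  the displacement is a contraction, so the shear is a homeomorphism (`PLIsotopy.shear`), and the
  inverse of a PL homeomorphism is PL (`IsPLOn.inverse`).
* Three shears, each of them the identity outside the cylinder over a square, turn the first
  coordinate axis into a curve whose projection has one double point: raise a tent, lift its left
  leg and lower its right leg, and slide the left leg to the right and the right leg to the left
  (`kinkIsotopy_axis`, `kinkCurve_double_point`).
* Each edge has an arc on which `Γ` is affine and which has a neighbourhood in the plane, a square,
  that meets no other part of the diagram (`SpatialGraph.HasDiagram.exists_straightArc`). An affine
  chart, whose plane part is a similarity that preserves the orientation, transports the model kink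
  into this square, and a reflection in the third coordinate gives the other sign.
* The double points of the new projection are the old ones and the crossing of the kink
  (`StraightArc.double_point_kinked_iff`), and the projection is unchanged near the old ones.
-/

open EdgeGraph

noncomputable section

/-! ### Calculus of piecewise-linear maps -/

section PLCalculus

variable {X Y Z : Type*} [AddCommGroup X] [Module ℝ X] [TopologicalSpace X]
  [AddCommGroup Y] [Module ℝ Y] [TopologicalSpace Y]
  [AddCommGroup Z] [Module ℝ Z] [TopologicalSpace Z]

theorem IsPLOn.comp {g : Y → Z} {f : X → Y} {P : Set X} {Q : Set Y} (hg : IsPLOn g Q)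
    (hf : IsPLOn f P) (hPQ : MapsTo f P Q) : IsPLOn (fun x => g (f x)) P := by
  refine ⟨hg.1.comp hf.1 hPQ, fun a ha => ?_⟩
  obtain ⟨U, hU, hUf⟩ := hf.2 a ha
  obtain ⟨W, hW, hWg⟩ := hg.2 (f a) (hPQ ha)
  obtain ⟨U', hU', hsub⟩ := mem_nhdsWithin_iff_exists_mem_nhds_inter.1 (hf.1 a ha hW)
  refine ⟨U ∩ U', inter_mem hU hU', fun x hx μ hμ => ?_⟩
  simp only
  rw [hUf x ⟨hx.1.1, hx.2⟩ μ hμ, hWg (f x) ⟨hsub ⟨hx.1.2, hx.2⟩, hPQ hx.2⟩ μ hμ]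

theorem IsPLOn.prodMk {f : X → Y} {g : X → Z} {P : Set X} (hf : IsPLOn f P) (hg : IsPLOn g P) :
    IsPLOn (fun x => (f x, g x)) P := by
  refine ⟨hf.1.prodMk hg.1, fun a ha => ?_⟩
  obtain ⟨U, hU, hUf⟩ := hf.2 a ha
  obtain ⟨W, hW, hWg⟩ := hg.2 a ha
  refine ⟨U ∩ W, inter_mem hU hW, fun x hx μ hμ => ?_⟩
  exact Prod.ext (hUf x ⟨hx.1.1, hx.2⟩ μ hμ) (hWg x ⟨hx.1.2, hx.2⟩ μ hμ)

theorem ContinuousLinearMap.isPLOn (f : X →L[ℝ] Y) (P : Set X) : IsPLOn f P :=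
  ⟨f.continuous.continuousOn, fun _ _ => ⟨univ, univ_mem, fun x _ μ _ => by simp⟩⟩

theorem isPLOn_const (b : Y) (P : Set X) : IsPLOn (fun _ => b) P :=
  ⟨continuousOn_const, fun _ _ => ⟨univ, univ_mem, fun x _ μ _ => by
    rw [← add_smul, sub_add_cancel, one_smul]⟩⟩

theorem isPLOn_id (P : Set X) : IsPLOn (fun x => x) P :=
  (ContinuousLinearMap.id ℝ X).isPLOn P

theorem isPLOn_fst (P : Set (X × Y)) : IsPLOn (fun p => p.1) P :=
  (ContinuousLinearMap.fst ℝ X Y).isPLOn P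

theorem isPLOn_snd (P : Set (X × Y)) : IsPLOn (fun p => p.2) P :=
  (ContinuousLinearMap.snd ℝ X Y).isPLOn P

theorem isPLOn_apply (i : Fin 3) (P : Set Space3) : IsPLOn (fun x => x i) P :=
  (ContinuousLinearMap.proj (R := ℝ) (φ := fun _ : Fin 3 => ℝ) i).isPLOn P

theorem IsPLOn.add [IsTopologicalAddGroup Y] {f g : X → Y} {P : Set X} (hf : IsPLOn f P)
    (hg : IsPLOn g P) : IsPLOn (fun x => f x + g x) P :=
  IsPLOn.comp (g := fun p : Y × Y => p.1 + p.2)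
    ((ContinuousLinearMap.fst ℝ Y Y + ContinuousLinearMap.snd ℝ Y Y).isPLOn univ)
    (hf.prodMk hg) (mapsTo_univ _ _)

theorem IsPLOn.const_mul {f : X → ℝ} {P : Set X} (hf : IsPLOn f P) (r : ℝ) :
    IsPLOn (fun x => r * f x) P :=
  IsPLOn.comp (g := fun y : ℝ => r * y) ((r • ContinuousLinearMap.id ℝ ℝ).isPLOn univ) hf
    (mapsTo_univ _ _)

theorem IsPLOn.neg {f : X → ℝ} {P : Set X} (hf : IsPLOn f P) : IsPLOn (fun x => -f x) P := by
  simpa using hf.const_mul (-1)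

theorem IsPLOn.sub {f g : X → ℝ} {P : Set X} (hf : IsPLOn f P) (hg : IsPLOn g P) :
    IsPLOn (fun x => f x - g x) P := by
  simpa [sub_eq_add_neg] using hf.add hg.neg

theorem isPLOn_abs (P : Set ℝ) : IsPLOn (fun x : ℝ => |x|) P := by
  refine ⟨continuous_abs.continuousOn, fun a _ => ?_⟩
  simp only [smul_eq_mul]
  rcases lt_trichotomy a 0 with h | rfl | h
  · refine ⟨Iio 0, Iio_mem_nhds h, fun x hx μ hμ => ?_⟩
    have hx0 : x < 0 := hx.1
    rw [abs_of_neg h, abs_of_neg hx0, abs_of_nonpos]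
    · ring
    · nlinarith [mul_nonneg (sub_nonneg.2 hμ.2) (neg_nonneg.2 h.le),
        mul_nonneg hμ.1 (neg_nonneg.2 hx0.le)]
  · exact ⟨univ, univ_mem, fun x _ μ hμ => by simp [abs_mul, abs_of_nonneg hμ.1]⟩
  · refine ⟨Ioi 0, Ioi_mem_nhds h, fun x hx μ hμ => ?_⟩
    have hx0 : 0 < x := hx.1
    rw [abs_of_pos h, abs_of_pos hx0, abs_of_nonneg]
    nlinarith [mul_nonneg (sub_nonneg.2 hμ.2) h.le, mul_nonneg hμ.1 hx0.le]

theorem IsPLOn.abs {f : X → ℝ} {P : Set X} (hf : IsPLOn f P) : IsPLOn (fun x => |f x|) P :=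
  (isPLOn_abs univ).comp hf (mapsTo_univ _ _)

theorem IsPLOn.max {f g : X → ℝ} {P : Set X} (hf : IsPLOn f P) (hg : IsPLOn g P) :
    IsPLOn (fun x => max (f x) (g x)) P := by
  have := (((hf.add hg).add (hg.sub hf).abs).const_mul 2⁻¹)
  convert this using 2 with x
  simpa using sup_eq_half_smul_add_add_abs_sub ℝ (f x) (g x)

theorem IsPLOn.min {f g : X → ℝ} {P : Set X} (hf : IsPLOn f P) (hg : IsPLOn g P) :
    IsPLOn (fun x => min (f x) (g x)) P := by
  convert (hf.neg.max hg.neg).neg using 2 with x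
  rw [max_neg_neg, neg_neg]

/-- The inverse of a piecewise-linear homeomorphism is piecewise linear. -/
theorem IsPLOn.inverse {f : X → Y} {g : Y → X} {P : Set X} {Q : Set Y} (hf : IsPLOn f P)
    (hP : Convex ℝ P) (hg : ContinuousOn g Q) (hgQ : MapsTo g Q P)
    (hgf : LeftInvOn g f P) (hfg : RightInvOn g f Q) : IsPLOn g Q := by
  refine ⟨hg, fun b hb => ?_⟩
  obtain ⟨U, hU, hUf⟩ := hf.2 (g b) (hgQ hb)
  obtain ⟨W, hW, hsub⟩ := mem_nhdsWithin_iff_exists_mem_nhds_inter.1 (hg b hb hU)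
  refine ⟨W, hW, fun y hy μ hμ => ?_⟩
  have hx := hUf (g y) ⟨hsub hy, hgQ hy.2⟩ μ hμ
  rw [hfg hb, hfg hy.2] at hx
  rw [← hx, hgf (hP (hgQ hb) (hgQ hy.2) (sub_nonneg.2 hμ.2) hμ.1 (by ring))]

end PLCalculus

/-! ### Truncation of real numbers -/

/-- The truncation of `u` to the interval `[-w, w]` (for `0 ≤ w`). -/
def clamp (w u : ℝ) : ℝ := max (-w) (min w u)

theorem clamp_eq_self {w u : ℝ} (h : |u| ≤ w) : clamp w u = u := by
  rw [clamp, min_eq_right (abs_le.1 h).2, max_eq_right (abs_le.1 h).1]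

theorem clamp_zero (u : ℝ) : clamp 0 u = 0 := by
  simp [clamp]

theorem abs_clamp_le {w u : ℝ} (hw : 0 ≤ w) : |clamp w u| ≤ w := by
  refine abs_le.2 ⟨le_max_left _ _, max_le (by linarith) (min_le_left _ _)⟩

theorem abs_clamp_sub_clamp_le (w u w' u' : ℝ) :
    |clamp w u - clamp w' u'| ≤ max |w - w'| |u - u'| := by
  refine (abs_max_sub_max_le_max _ _ _ _).trans (max_le ?_ (abs_min_sub_min_le_max _ _ _ _))
  rw [← abs_neg]
  exact le_max_of_le_left (le_of_eq (by ring_nf))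

theorem IsPLOn.clamp {X : Type*} [AddCommGroup X] [Module ℝ X] [TopologicalSpace X]
    {f g : X → ℝ} {P : Set X} (hf : IsPLOn f P) (hg : IsPLOn g P) :
    IsPLOn (fun x => clamp (f x) (g x)) P :=
  hf.neg.max (hf.min hg)

/-! ### Piecewise-linear isotopies -/

namespace PLIsotopy

theorem convex_domain : Convex ℝ ((univ : Set Space3) ×ˢ Icc (0 : ℝ) 1) :=
  convex_univ.prod (convex_Icc 0 1)

theorem isPLOn_time (h : PLIsotopy) {t : ℝ} (ht : t ∈ Icc (0 : ℝ) 1) :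
    IsPLOn (h.toFun t) univ :=
  h.isPLOn_toFun.comp ((isPLOn_id univ).prodMk (isPLOn_const t univ))
    (fun x _ => ⟨mem_univ x, ht⟩)

/-- The composition of two isotopies, level by level. -/
def trans (h k : PLIsotopy) : PLIsotopy where
  toFun t x := k.toFun t (h.toFun t x)
  inv t x := h.inv t (k.inv t x)
  isPLOn_toFun := k.isPLOn_toFun.comp (h.isPLOn_toFun.prodMk (isPLOn_snd _))
    (fun p hp => ⟨mem_univ _, hp.2⟩)
  isPLOn_inv := h.isPLOn_inv.comp (k.isPLOn_inv.prodMk (isPLOn_snd _))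
    (fun p hp => ⟨mem_univ _, hp.2⟩)
  left_inv t ht x := by simp only [k.left_inv t ht _, h.left_inv t ht _]
  right_inv t ht x := by simp only [h.right_inv t ht _, k.right_inv t ht _]
  zero x := by simp only [h.zero, k.zero]

/-- The conjugate of an isotopy by an affine automorphism `y ↦ b + L y` of `ℝ³`. -/
def conj (h : PLIsotopy) (L : Space3 ≃ₗ[ℝ] Space3) (b : Space3) : PLIsotopy where
  toFun t x := b + L (h.toFun t (L.symm (x - b)))
  inv t x := b + L (h.inv t (L.symm (x - b)))
  isPLOn_toFun := by
    have hin : IsPLOn (fun p : Space3 × ℝ => L.symm (p.1 - b)) (univ ×ˢ Icc (0 : ℝ) 1) :=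
      (L.symm.toContinuousLinearEquiv.toContinuousLinearMap.isPLOn univ).comp
        (by simpa [sub_eq_add_neg] using (isPLOn_fst _).add (isPLOn_const (-b) _))
        (mapsTo_univ _ _)
    exact (isPLOn_const b _).add
      ((L.toContinuousLinearEquiv.toContinuousLinearMap.isPLOn univ).comp
        (h.isPLOn_toFun.comp (hin.prodMk (isPLOn_snd _)) (fun p hp => ⟨mem_univ _, hp.2⟩))
        (mapsTo_univ _ _))
  isPLOn_inv := by
    have hin : IsPLOn (fun p : Space3 × ℝ => L.symm (p.1 - b)) (univ ×ˢ Icc (0 : ℝ) 1) :=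
      (L.symm.toContinuousLinearEquiv.toContinuousLinearMap.isPLOn univ).comp
        (by simpa [sub_eq_add_neg] using (isPLOn_fst _).add (isPLOn_const (-b) _))
        (mapsTo_univ _ _)
    exact (isPLOn_const b _).add
      ((L.toContinuousLinearEquiv.toContinuousLinearMap.isPLOn univ).comp
        (h.isPLOn_inv.comp (hin.prodMk (isPLOn_snd _)) (fun p hp => ⟨mem_univ _, hp.2⟩))
        (mapsTo_univ _ _))
  left_inv t ht x := by simp [h.left_inv t ht _]
  right_inv t ht x := by simp [h.right_inv t ht _]
  zero x := by simp [h.zero]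

end PLIsotopy

/-- The displacement at time `t` of the point `x` in the shear of amplitude `φ`. The factor `t` must
not multiply `φ`, which would destroy piecewise linearity; instead, it bounds the truncation. -/
def shearAmount (φ : Space3 → ℝ) (M t : ℝ) (x : Space3) : ℝ := clamp (t * M) (φ x)

section Shear

variable {φ : Space3 → ℝ} {M : ℝ} {v : Space3}

theorem isPLOn_shearAmount (hφ : IsPLOn φ univ) (M : ℝ) (P : Set (Space3 × ℝ)) :
    IsPLOn (fun p : Space3 × ℝ => shearAmount φ M p.2 p.1) P := by
  refine IsPLOn.clamp ?_ (hφ.comp (isPLOn_fst P) (mapsTo_univ _ _))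
  simpa [mul_comm] using (isPLOn_snd P).const_mul M

theorem abs_shearAmount_sub_le (hv : ∀ x s, |φ (x + s • v) - φ x| ≤ |s| / 2) (t : ℝ) (x : Space3)
    (s s' : ℝ) :
    |shearAmount φ M t (x + s • v) - shearAmount φ M t (x + s' • v)| ≤ |s - s'| / 2 := by
  refine (abs_clamp_sub_clamp_le _ _ _ _).trans (max_le (by simp; positivity) ?_)
  have := hv (x + s' • v) (s - s')
  rwa [add_assoc, ← add_smul, add_sub_cancel] at this

/-- On each line of direction `v`, the shear can be inverted: its displacement is a contraction. -/
theorem existsUnique_shear_preimage (hv : ∀ x s, |φ (x + s • v) - φ x| ≤ |s| / 2)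
    (M t : ℝ) (y : Space3) : ∃! s : ℝ, s = -shearAmount φ M t (y + s • v) := by
  have hc : ContractingWith (1 / 2) (fun s : ℝ => -shearAmount φ M t (y + s • v)) := by
    refine ⟨by norm_num, LipschitzWith.of_dist_le_mul fun s s' => ?_⟩
    rw [Real.dist_eq, Real.dist_eq, neg_sub_neg, abs_sub_comm]
    refine (abs_shearAmount_sub_le hv t y s s').trans (le_of_eq ?_)
    push_cast
    ring
  exact ⟨hc.fixedPoint _, hc.fixedPoint_isFixedPt.symm,
    fun s hs => hc.fixedPoint_unique (x := s) hs.symm⟩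

/-- The signed distance, in units of `v`, from `y` to its preimage under the shear at time `t`. -/
def shearInvAmount (hv : ∀ x s, |φ (x + s • v) - φ x| ≤ |s| / 2) (M t : ℝ) (y : Space3) : ℝ :=
  (existsUnique_shear_preimage hv M t y).choose

theorem shearInvAmount_spec (hv : ∀ x s, |φ (x + s • v) - φ x| ≤ |s| / 2) (M t : ℝ)
    (y : Space3) :
    shearInvAmount hv M t y = -shearAmount φ M t (y + shearInvAmount hv M t y • v) :=
  (existsUnique_shear_preimage hv M t y).choose_spec.1

theorem eq_shearInvAmount (hv : ∀ x s, |φ (x + s • v) - φ x| ≤ |s| / 2) {M t : ℝ}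
    {y : Space3} {s : ℝ} (hs : s = -shearAmount φ M t (y + s • v)) :
    s = shearInvAmount hv M t y :=
  (existsUnique_shear_preimage hv M t y).choose_spec.2 s hs

theorem continuous_shearInvAmount (hφ : IsPLOn φ univ)
    (hv : ∀ x s, |φ (x + s • v) - φ x| ≤ |s| / 2) (M : ℝ) :
    Continuous (fun p : Space3 × ℝ => shearInvAmount hv M p.2 p.1) := by
  have hcont : Continuous (fun p : Space3 × ℝ => shearAmount φ M p.2 p.1) :=
    continuousOn_univ.1 (isPLOn_shearAmount hφ M univ).1
  rw [continuous_iff_continuousAt]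
  intro q
  set s₀ := shearInvAmount hv M q.2 q.1 with hs₀
  -- the fixed point of a contraction depends continuously on the contraction
  have hbound : ∀ p : Space3 × ℝ, |shearInvAmount hv M p.2 p.1 - s₀| ≤
      2 * |shearAmount φ M q.2 (q.1 + s₀ • v) - shearAmount φ M p.2 (p.1 + s₀ • v)| := by
    intro p
    have h1 := shearInvAmount_spec hv M p.2 p.1
    have h2 := shearInvAmount_spec hv M q.2 q.1
    rw [← hs₀] at h2
    set s := shearInvAmount hv M p.2 p.1
    have h3 := abs_shearAmount_sub_le (M := M) hv p.2 p.1 s s₀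
    have h4 : s - s₀ = (shearAmount φ M q.2 (q.1 + s₀ • v) - shearAmount φ M p.2 (p.1 + s₀ • v)) -
        (shearAmount φ M p.2 (p.1 + s • v) - shearAmount φ M p.2 (p.1 + s₀ • v)) := by
      linarith
    have h5 := abs_sub (shearAmount φ M q.2 (q.1 + s₀ • v) - shearAmount φ M p.2 (p.1 + s₀ • v))
        (shearAmount φ M p.2 (p.1 + s • v) - shearAmount φ M p.2 (p.1 + s₀ • v))
    rw [← h4] at h5
    linarith
  rw [ContinuousAt, tendsto_iff_dist_tendsto_zero]
  refine squeeze_zero (fun _ => dist_nonneg) hbound ?_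
  have hc : Continuous (fun p : Space3 × ℝ =>
      2 * |shearAmount φ M q.2 (q.1 + s₀ • v) - shearAmount φ M p.2 (p.1 + s₀ • v)|) := by
    have : Continuous (fun p : Space3 × ℝ => shearAmount φ M p.2 (p.1 + s₀ • v)) :=
      hcont.comp (((continuous_fst.add continuous_const).prodMk continuous_snd))
    fun_prop
  simpa using hc.tendsto q

/-- The shear in the direction `v` with a piecewise-linear amplitude `φ`, bounded by `M`, whose
slope in the direction `v` is at most `1 / 2`. -/
def PLIsotopy.shear (hφ : IsPLOn φ univ) (hv : ∀ x s, |φ (x + s • v) - φ x| ≤ |s| / 2) (M : ℝ) :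
    PLIsotopy :=
  have hto : IsPLOn (fun p : Space3 × ℝ => p.1 + shearAmount φ M p.2 p.1 • v)
      (univ ×ˢ Icc (0 : ℝ) 1) :=
    (isPLOn_fst _).add (IsPLOn.comp (g := fun r : ℝ => r • v)
      ((ContinuousLinearMap.toSpanSingleton ℝ v).isPLOn univ) (isPLOn_shearAmount hφ M _)
      (mapsTo_univ _ _))
  have hleft : ∀ t x, x + shearAmount φ M t x • v +
      shearInvAmount hv M t (x + shearAmount φ M t x • v) • v = x := fun t x => by
    rw [← eq_shearInvAmount (s := -shearAmount φ M t x) hv]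
    · simp
    · simp
  have hright : ∀ t y, y + shearInvAmount hv M t y • v +
      shearAmount φ M t (y + shearInvAmount hv M t y • v) • v = y := fun t y => by
    nth_rw 1 [shearInvAmount_spec hv M t y]
    simp
  { toFun := fun t x => x + shearAmount φ M t x • v
    inv := fun t y => y + shearInvAmount hv M t y • v
    isPLOn_toFun := hto
    isPLOn_inv := by
      have hinv := (hto.prodMk (isPLOn_snd _)).inverse (Q := univ ×ˢ Icc (0 : ℝ) 1)
        (g := fun p : Space3 × ℝ => (p.1 + shearInvAmount hv M p.2 p.1 • v, p.2))
        PLIsotopy.convex_domain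
        (((continuous_fst.add ((continuous_shearInvAmount hφ hv M).smul
          continuous_const)).prodMk continuous_snd).continuousOn)
        (fun p hp => ⟨mem_univ _, hp.2⟩)
        (fun p _ => Prod.ext (hleft p.2 p.1) rfl) (fun p _ => Prod.ext (hright p.2 p.1) rfl)
      exact (isPLOn_fst univ).comp hinv (mapsTo_univ _ _)
    left_inv := fun t _ x => hleft t x
    right_inv := fun t _ y => hright t y
    zero := fun x => by simp [shearAmount, clamp_zero] }

theorem PLIsotopy.shear_one (hφ : IsPLOn φ univ) (hv : ∀ x s, |φ (x + s • v) - φ x| ≤ |s| / 2)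
    {x : Space3} (hM : |φ x| ≤ M) : (PLIsotopy.shear hφ hv M).toFun 1 x = x + φ x • v := by
  simp [PLIsotopy.shear, shearAmount, clamp_eq_self hM]

end Shear

/-! ### The model kink -/

/-- The second coordinate of the kink curve: a tent over `[-1, 1]`. -/
def kinkTent (s : ℝ) : ℝ := max 0 (1 - |s|)

/-- The third coordinate of the kink curve: a positive tent over the left leg `[-1, 0]` of the
tent `kinkTent` and a negative one over its right leg `[0, 1]`. -/
def kinkHeight (s : ℝ) : ℝ := clamp (2 * kinkTent s) (-2 * s)

/-- The kink curve. Its legs have been pushed past each other in the direction of the first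
coordinate, the left one to the right, above the other one. -/
def kinkCurve (s : ℝ) : Space3 := ![s + kinkHeight s, kinkTent s, kinkHeight s]

theorem kinkTent_of_one_le {s : ℝ} (hs : 1 ≤ |s|) : kinkTent s = 0 :=
  max_eq_left (by linarith)

theorem kinkTent_of_le_one {s : ℝ} (hs : |s| ≤ 1) : kinkTent s = 1 - |s| :=
  max_eq_right (by linarith)

theorem kinkTent_mem (s : ℝ) : kinkTent s ∈ Icc (0 : ℝ) 1 :=
  ⟨le_max_left _ _, max_le zero_le_one (by linarith [abs_nonneg s])⟩

theorem kinkHeight_of_one_le {s : ℝ} (hs : 1 ≤ |s|) : kinkHeight s = 0 := by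
  rw [kinkHeight, kinkTent_of_one_le hs, mul_zero, clamp_zero]

theorem kinkHeight_neg (s : ℝ) : kinkHeight (-s) = -kinkHeight s := by
  simp only [kinkHeight, kinkTent, abs_neg, clamp]
  rcases max_cases 0 (1 - |s|) with h | h <;>
  rcases min_cases (2 * max 0 (1 - |s|)) (-2 * -s) with h1 | h1 <;>
  rcases min_cases (2 * max 0 (1 - |s|)) (-2 * s) with h2 | h2 <;>
  rw [h1.1, h2.1] <;>
  simp only [max_def] <;> split_ifs <;> linarith

theorem kinkHeight_of_mem_Icc {s : ℝ} (h0 : 0 ≤ s) (h1 : s ≤ 1) :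
    kinkHeight s = -(2 * min s (1 - s)) := by
  rw [kinkHeight, kinkTent_of_le_one (abs_le.2 ⟨by linarith, h1⟩), abs_of_nonneg h0, clamp,
    min_eq_right (by linarith)]
  rcases min_cases s (1 - s) with h | h <;> rw [h.1] <;> simp only [max_def] <;> split_ifs <;>
    linarith

theorem abs_kinkHeight_le (s : ℝ) : |kinkHeight s| ≤ 1 := by
  wlog hs : 0 ≤ s generalizing s
  · simpa [kinkHeight_neg] using this (-s) (by linarith)
  rcases le_total 1 s with h | h
  · rw [kinkHeight_of_one_le (h.trans (le_abs_self s))]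
    simp
  · rw [kinkHeight_of_mem_Icc hs h, abs_neg, abs_of_nonneg]
    · rcases min_cases s (1 - s) with h | h <;> rw [h.1] <;> linarith
    · exact mul_nonneg zero_le_two (le_min hs (by linarith))

/-- The kink curve stays over the open square in which the kink takes place. -/
theorem abs_kinkCurve_lt {s : ℝ} (hs : |s| < 4) : |kinkCurve s 0| < 4 ∧ |kinkCurve s 1| < 4 := by
  have ht := kinkTent_mem s
  simp only [kinkCurve, Matrix.cons_val_zero, Matrix.cons_val_one]
  refine ⟨?_, by rw [abs_of_nonneg ht.1]; linarith [ht.2]⟩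
  rcases le_total 1 |s| with h | h
  · rwa [kinkHeight_of_one_le h, add_zero]
  · have := abs_add_le s (kinkHeight s)
    linarith [abs_kinkHeight_le s]

/-- The projected kink curve has exactly one double point, at the parameters `± 2 / 3`. -/
theorem kinkCurve_double_point {s s' : ℝ} (hne : s ≠ s')
    (h0 : kinkCurve s 0 = kinkCurve s' 0) (h1 : kinkCurve s 1 = kinkCurve s' 1) :
    (s = 2 / 3 ∧ s' = -(2 / 3)) ∨ (s = -(2 / 3) ∧ s' = 2 / 3) := by
  simp only [kinkCurve, Matrix.cons_val_zero, Matrix.cons_val_one] at h0 h1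
  have key : ∀ s : ℝ, 0 < s → s < 1 → s + kinkHeight s = 0 → s = 2 / 3 := by
    intro s hs hs1 h
    rw [kinkHeight_of_mem_Icc hs.le hs1.le] at h
    rcases min_cases s (1 - s) with h' | h' <;> rw [h'.1] at h <;> linarith
  rcases le_or_gt 1 |s| with h | h
  · have h' : 1 ≤ |s'| := by
      by_contra! hlt
      rw [kinkTent_of_one_le h, kinkTent_of_le_one hlt.le] at h1
      linarith
    rw [kinkHeight_of_one_le h, kinkHeight_of_one_le h', add_zero, add_zero] at h0
    exact absurd h0 hne
  · have h' : |s'| < 1 := by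
      by_contra! hle
      rw [kinkTent_of_one_le hle, kinkTent_of_le_one h.le] at h1
      linarith
    rw [kinkTent_of_le_one h.le, kinkTent_of_le_one h'.le] at h1
    have hs' : s = -s' := (abs_eq_abs.1 (by linarith)).resolve_left hne
    have hz : s' + kinkHeight s' = 0 := by
      rw [hs', kinkHeight_neg] at h0
      linarith
    rcases lt_trichotomy s' 0 with hneg | h00 | hpos
    · left
      have := key s (by linarith) (abs_lt.1 h).2 (by rw [hs', kinkHeight_neg]; linarith)
      exact ⟨this, by linarith⟩
    · exact absurd (by linarith) hne
    · right
      have := key s' hpos (abs_lt.1 h').2 hz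
      exact ⟨by linarith, this⟩

/-- The right leg (`σ = 1`) and the left leg (`σ = -1`) of the kink curve near its double point. -/
theorem kinkCurve_near_double_point {σ τ : ℝ} (hσ : σ = 1 ∨ σ = -1) (hτ : |τ| ≤ 1 / 6) :
    kinkCurve (σ * (2 / 3) + τ) = ![3 * τ, 1 / 3 - σ * τ, 2 * τ - σ * (2 / 3)] := by
  have h := abs_le.1 hτ
  have key : kinkHeight (σ * (2 / 3) + τ) = 2 * τ - σ * (2 / 3) ∧
      kinkTent (σ * (2 / 3) + τ) = 1 / 3 - σ * τ := by
    rcases hσ with rfl | rfl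
    · rw [kinkHeight_of_mem_Icc (by linarith) (by linarith), min_eq_right (by linarith),
        kinkTent_of_le_one (by rw [abs_of_nonneg] <;> linarith), abs_of_nonneg (by linarith)]
      constructor <;> ring
    · rw [show -1 * (2 / 3) + τ = -(2 / 3 - τ) by ring, kinkHeight_neg,
        kinkHeight_of_mem_Icc (by linarith) (by linarith), min_eq_right (by linarith),
        kinkTent_of_le_one (by rw [abs_neg, abs_of_nonneg] <;> linarith), abs_neg,
        abs_of_nonneg (by linarith)]
      constructor <;> ring
  rw [kinkCurve, key.1, key.2, show σ * (2 / 3) + τ + (2 * τ - σ * (2 / 3)) = 3 * τ by ring]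

/-! ### The isotopy that produces the model kink -/

/-- A plateau of height at least `1` over the square `|x|, |y| ≤ 1`, vanishing outside the square
`|x|, |y| < 3`. -/
def plateau (x : Space3) : ℝ := max 0 ((3 - max |x 0| |x 1|) / 2)

/-- The amplitude of the shear that raises the tent of the kink. -/
def tentAmplitude (x : Space3) : ℝ := max 0 (1 - |x 0| - |x 1| / 2)

/-- The amplitude of the shear that lifts the left leg of the tent and lowers the right one. -/
def liftAmplitude (x : Space3) : ℝ := clamp (max 0 (min (2 * x 1) (plateau x))) (-2 * x 0)

/-- The amplitude of the shear that pushes the legs of the tent past each other. -/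
def slideAmplitude (x : Space3) : ℝ := clamp (plateau x) (x 2)

theorem isPLOn_plateau : IsPLOn plateau univ := by
  have h := (((isPLOn_const (3 : ℝ) univ).sub
    ((isPLOn_apply 0 univ).abs.max (isPLOn_apply 1 univ).abs)).const_mul 2⁻¹)
  simp only [inv_mul_eq_div] at h
  exact (isPLOn_const (0 : ℝ) univ).max h

theorem isPLOn_tentAmplitude : IsPLOn tentAmplitude univ := by
  have h := ((isPLOn_const (1 : ℝ) univ).sub (isPLOn_apply 0 univ).abs).sub
    ((isPLOn_apply 1 univ).abs.const_mul 2⁻¹)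
  simp only [inv_mul_eq_div] at h
  exact (isPLOn_const (0 : ℝ) univ).max h

theorem isPLOn_liftAmplitude : IsPLOn liftAmplitude univ :=
  ((isPLOn_const (0 : ℝ) univ).max
    (((isPLOn_apply 1 univ).const_mul 2).min isPLOn_plateau)).clamp
    ((isPLOn_apply 0 univ).const_mul (-2))

theorem isPLOn_slideAmplitude : IsPLOn slideAmplitude univ :=
  isPLOn_plateau.clamp (isPLOn_apply 2 univ)

theorem plateau_nonneg (x : Space3) : 0 ≤ plateau x := le_max_left _ _

theorem plateau_le (x : Space3) : plateau x ≤ 3 / 2 :=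
  max_le (by norm_num) (by linarith [abs_nonneg (x 0), le_max_left |x 0| |x 1|])

theorem one_le_plateau {x : Space3} (h0 : |x 0| ≤ 1) (h1 : |x 1| ≤ 1) : 1 ≤ plateau x :=
  le_max_of_le_right (by linarith [max_le h0 h1])

theorem plateau_eq_zero {x : Space3} (h : 3 ≤ |x 0| ∨ 3 ≤ |x 1|) : plateau x = 0 :=
  max_eq_left (by linarith [le_max_iff.2 h])

theorem abs_tentAmplitude_le (x : Space3) : |tentAmplitude x| ≤ 1 := by
  rw [tentAmplitude, abs_of_nonneg (le_max_left _ _)]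
  exact max_le zero_le_one (by linarith [abs_nonneg (x 0), abs_nonneg (x 1)])

theorem abs_liftAmplitude_le (x : Space3) : |liftAmplitude x| ≤ 3 / 2 :=
  (abs_clamp_le (le_max_left _ _)).trans
    (max_le (by norm_num) ((min_le_right _ _).trans (plateau_le x)))

theorem abs_slideAmplitude_le (x : Space3) : |slideAmplitude x| ≤ 3 / 2 :=
  (abs_clamp_le (plateau_nonneg x)).trans (plateau_le x)

theorem tentAmplitude_slope (x : Space3) (s : ℝ) :
    |tentAmplitude (x + s • Pi.single 1 1) - tentAmplitude x| ≤ |s| / 2 := by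
  rw [tentAmplitude, tentAmplitude, max_comm 0, max_comm 0]
  refine (abs_max_sub_max_le_abs _ _ _).trans ?_
  have h := abs_abs_sub_abs_le (x 1) (x 1 + s)
  rw [sub_add_cancel_left, abs_neg] at h
  have h0 : (x + s • Pi.single 1 1 : Space3) 0 = x 0 := by simp
  have h1 : (x + s • Pi.single 1 1 : Space3) 1 = x 1 + s := by simp
  rw [h0, h1, sub_sub_sub_cancel_left, ← sub_div, abs_div, abs_two]
  linarith

theorem liftAmplitude_slope (x : Space3) (s : ℝ) :
    |liftAmplitude (x + s • Pi.single 2 1) - liftAmplitude x| ≤ |s| / 2 := by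
  simp [liftAmplitude, plateau]
  positivity

theorem slideAmplitude_slope (x : Space3) (s : ℝ) :
    |slideAmplitude (x + s • Pi.single 0 1) - slideAmplitude x| ≤ |s| / 2 := by
  refine (abs_clamp_sub_clamp_le _ _ _ _).trans (max_le ?_ (by simp; positivity))
  rw [plateau, plateau, max_comm 0, max_comm 0]
  refine (abs_max_sub_max_le_abs _ _ _).trans ?_
  rw [← sub_div, abs_div, abs_two, sub_sub_sub_cancel_left]
  refine div_le_div_of_nonneg_right ((abs_max_sub_max_le_max _ _ _ _).trans
    (max_le ((abs_abs_sub_abs_le _ _).trans ?_) ?_)) zero_le_two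
  · simp
  · simp

/-- The isotopy that raises a tent on the first coordinate axis, then lifts one of its legs and
lowers the other one, and finally pushes the legs past each other. -/
def kinkIsotopy : PLIsotopy :=
  ((PLIsotopy.shear isPLOn_tentAmplitude tentAmplitude_slope 1).trans
    (PLIsotopy.shear isPLOn_liftAmplitude liftAmplitude_slope (3 / 2))).trans
    (PLIsotopy.shear isPLOn_slideAmplitude slideAmplitude_slope (3 / 2))

theorem kinkIsotopy_one (x y z : Space3) (hy : y = x + tentAmplitude x • Pi.single 1 1)
    (hz : z = y + liftAmplitude y • Pi.single 2 1) :
    kinkIsotopy.toFun 1 x = z + slideAmplitude z • Pi.single 0 1 := by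
  subst hz hy
  simp only [kinkIsotopy, PLIsotopy.trans, PLIsotopy.shear_one _ _ (abs_tentAmplitude_le _),
    PLIsotopy.shear_one _ _ (abs_liftAmplitude_le _),
    PLIsotopy.shear_one _ _ (abs_slideAmplitude_le _)]

theorem kinkIsotopy_of_outside {x : Space3} (h : 3 ≤ |x 0| ∨ 3 ≤ |x 1|) :
    kinkIsotopy.toFun 1 x = x := by
  have h1 : tentAmplitude x = 0 := max_eq_left <| by
    rcases h with h | h <;> linarith [abs_nonneg (x 0), abs_nonneg (x 1)]
  have h2 : liftAmplitude x = 0 := by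
    rw [liftAmplitude, plateau_eq_zero h, max_eq_left (min_le_right _ _), clamp_zero]
  have h3 : slideAmplitude x = 0 := by
    rw [slideAmplitude, plateau_eq_zero h, clamp_zero]
  rw [kinkIsotopy_one x x x (by simp [h1]) (by simp [h2]), h3, zero_smul, add_zero]

theorem kinkIsotopy_axis (s : ℝ) : kinkIsotopy.toFun 1 ![s, 0, 0] = kinkCurve s := by
  have ht := kinkTent_mem s
  have h1 : tentAmplitude ![s, 0, 0] = kinkTent s := by simp [tentAmplitude, kinkTent]
  have h2 : liftAmplitude ![s, kinkTent s, 0] = kinkHeight s := by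
    rw [liftAmplitude, kinkHeight]
    simp only [Matrix.cons_val_zero, Matrix.cons_val_one]
    rcases le_total 1 |s| with h | h
    · rw [kinkTent_of_one_le h, mul_zero, max_eq_left (min_le_left _ _)]
    · have hp : 1 ≤ plateau ![s, kinkTent s, 0] :=
        one_le_plateau (by simpa using h) (by simpa [abs_of_nonneg ht.1] using ht.2)
      rw [max_eq_right (le_min (by linarith [ht.1]) (plateau_nonneg _))]
      rw [kinkTent_of_le_one h] at hp ⊢
      -- one of the bounds `2 * kinkTent s` and `2 * |s|` is at most `1`
      rcases le_total (2 * (1 - |s|)) 1 with h' | h'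
      · rw [min_eq_left (h'.trans hp)]
      · have hs : |-2 * s| ≤ 1 := by
          rw [abs_mul, abs_neg, abs_two]
          linarith
        rw [clamp_eq_self (le_min (hs.trans h') (hs.trans hp)), clamp_eq_self (hs.trans h')]
  have h3 : slideAmplitude ![s, kinkTent s, kinkHeight s] = kinkHeight s := by
    rw [slideAmplitude]
    refine clamp_eq_self ?_
    simp only [Matrix.cons_val]
    rcases le_total 1 |s| with h | h
    · rw [kinkHeight_of_one_le h, abs_zero]
      exact plateau_nonneg _
    · exact (abs_kinkHeight_le s).trans
        (one_le_plateau (by simpa using h) (by simpa [abs_of_nonneg ht.1] using ht.2))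
  rw [kinkIsotopy_one _ ![s, kinkTent s, 0] ![s, kinkTent s, kinkHeight s], h3]
  · ext i
    fin_cases i <;> simp [kinkCurve]
  · rw [h1]
    ext i
    fin_cases i <;> simp
  · rw [h2]
    ext i
    fin_cases i <;> simp

/-! ### Points of the realization -/

namespace EdgeGraph

variable {V E : Type*} {G : EdgeGraph V E}

open Classical in
/-- The edge and the parameter of a point in the interior of an edge, and `none` at a vertex. -/
def interiorCoord (G : EdgeGraph V E) : G.Realization → Option (E × ℝ) :=
  Quot.lift (Sum.elim (fun _ => none)
    (fun p => if (p.2 : ℝ) ∈ Ioo (0 : ℝ) 1 then some (p.1, (p.2 : ℝ)) else none)) <| by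
    rintro _ _ (e | e) <;> simp

theorem interiorCoord_point (e : E) {a : ℝ} (ha : a ∈ Ioo (0 : ℝ) 1) :
    G.interiorCoord (G.point e a) = some (e, a) := by
  have h : (projIcc (0 : ℝ) 1 zero_le_one a : ℝ) = a := by
    rw [projIcc_of_mem zero_le_one (Ioo_subset_Icc_self ha)]
  simp only [interiorCoord, point, Sum.elim_inr, h, if_pos ha]

theorem eq_of_point_eq_point {e e' : E} {t a : ℝ} (ht : t ∈ Icc (0 : ℝ) 1)
    (ha : a ∈ Ioo (0 : ℝ) 1) (h : G.point e t = G.point e' a) : e = e' ∧ t = a := by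
  have := congrArg G.interiorCoord h
  rw [interiorCoord_point e' ha] at this
  simp only [interiorCoord, point, Sum.elim_inr, Option.ite_none_right_eq_some,
    Option.some_inj, Prod.mk_inj, projIcc_of_mem zero_le_one ht] at this
  exact this.2

theorem point_eq_point_iff {e e' : E} {a a' : ℝ} (ha : a ∈ Ioo (0 : ℝ) 1)
    (ha' : a' ∈ Ioo (0 : ℝ) 1) : G.point e a = G.point e' a' ↔ e = e' ∧ a = a' :=
  ⟨eq_of_point_eq_point (Ioo_subset_Icc_self ha) ha', fun ⟨h, h'⟩ => by rw [h, h']⟩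

theorem exists_eq_vertex_or_point (x : G.Realization) :
    (∃ v, x = Quot.mk _ (Sum.inl v)) ∨ ∃ e, ∃ t ∈ Icc (0 : ℝ) 1, x = G.point e t := by
  obtain ⟨v | ⟨e, t⟩, rfl⟩ := Quot.exists_rep x
  · exact Or.inl ⟨v, rfl⟩
  · exact Or.inr ⟨e, t, t.2, by rw [point, projIcc_val]⟩

end EdgeGraph

variable {V E : Type*} {G : EdgeGraph V E}

theorem continuous_planeProj : Continuous planeProj := by
  refine continuous_pi fun i => ?_
  fin_cases i
  · exact continuous_apply 0
  · exact continuous_apply 1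

/-! ### Straight arcs away from the rest of the diagram -/

/-- The linear part of the chart in which the kink is made: its plane part is the similarity that
maps the first basis vector to the projection of `d`, so it preserves the orientation of the plane;
the first basis vector itself is mapped to `d`, and the third one to its multiple by `σ = ± 1`. -/
def kinkChart (d : Space3) (hd : 0 < d 0 ^ 2 + d 1 ^ 2) (σ : ℝ) (hσ : σ * σ = 1) :
    Space3 ≃ₗ[ℝ] Space3 where
  toFun y := ![y 0 * d 0 - y 1 * d 1, y 0 * d 1 + y 1 * d 0, y 0 * d 2 + σ * y 2]
  map_add' x y := by ext i; fin_cases i <;> simp <;> ring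
  map_smul' r x := by ext i; fin_cases i <;> simp <;> ring
  invFun x := ![(x 0 * d 0 + x 1 * d 1) / (d 0 ^ 2 + d 1 ^ 2),
    (x 1 * d 0 - x 0 * d 1) / (d 0 ^ 2 + d 1 ^ 2),
    σ * (x 2 - (x 0 * d 0 + x 1 * d 1) / (d 0 ^ 2 + d 1 ^ 2) * d 2)]
  left_inv y := by
    ext i
    fin_cases i
    · simp; field_simp; ring
    · simp; field_simp; ring
    · simp; field_simp; linear_combination (d 0 ^ 2 + d 1 ^ 2) * y 2 * hσ
  right_inv y := by
    ext i
    fin_cases i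
    · simp; field_simp; ring
    · simp; field_simp; ring
    · simp; field_simp; linear_combination
        (y 2 * (d 0 ^ 2 + d 1 ^ 2) - (y 0 * d 0 + y 1 * d 1) * d 2) * hσ

theorem kinkChart_apply (d : Space3) (hd : 0 < d 0 ^ 2 + d 1 ^ 2) (σ : ℝ) (hσ : σ * σ = 1)
    (y : Space3) : kinkChart d hd σ hσ y =
      ![y 0 * d 0 - y 1 * d 1, y 0 * d 1 + y 1 * d 0, y 0 * d 2 + σ * y 2] := rfl

/-- An arc of the edge `e`, parametrized by `s ∈ (-4, 4)`, that `Γ` maps affinely with velocity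
`dir`, such that no other part of the diagram meets the open square of the plane of which the
projection of the arc is the midline (`u` and `v` being the coordinates along and across it).
The model kink only needs the square `|u|, |v| < 3`; the margin ensures that points outside the
arc have neighbourhoods that the kink does not move. -/
structure StraightArc (Γ : SpatialGraph G) (e : E) where
  center : ℝ
  scale : ℝ
  dir : Space3
  scale_pos : 0 < scale
  dir_pos : 0 < dir 0 ^ 2 + dir 1 ^ 2
  mem_Ioo : ∀ s, |s| < 4 → center + s * scale ∈ Ioo (0 : ℝ) 1
  affine : ∀ s, |s| < 4 →
    Γ.toFun (G.point e (center + s * scale)) = Γ.toFun (G.point e center) + s • dir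
  isolated : ∀ x u v, |u| < 4 → |v| < 4 →
    planeProj (Γ.toFun x) = planeProj (Γ.toFun (G.point e center)) +
      ![u * dir 0 - v * dir 1, u * dir 1 + v * dir 0] →
    ∃ s, |s| < 4 ∧ x = G.point e (center + s * scale)

/-- A piecewise-linear path is affine on a short interval to the right of `1 / 2`. -/
theorem SpatialGraph.exists_affine (Γ : SpatialGraph G) (e : E) :
    ∃ r ∈ Ioo (0 : ℝ) (1 / 2), ∃ d : Space3, ∀ u ∈ Icc 0 r,
      Γ.toFun (G.point e (1 / 2 + u)) = Γ.toFun (G.point e (1 / 2)) + u • d := by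
  obtain ⟨U, hU, h⟩ := (Γ.isPLOn e).2 (1 / 2) (by norm_num)
  obtain ⟨ρ, hρ, hball⟩ := Metric.mem_nhds_iff.1 hU
  have hr : 0 < min (ρ / 2) (1 / 4) := by positivity
  set r := min (ρ / 2) (1 / 4)
  have hr1 : r ≤ ρ / 2 := min_le_left _ _
  have hr2 : r ≤ 1 / 4 := min_le_right _ _
  refine ⟨r, ⟨hr, by linarith⟩, r⁻¹ • (Γ.toFun (G.point e (1 / 2 + r)) -
    Γ.toFun (G.point e (1 / 2))), fun u hu => ?_⟩
  have := h (1 / 2 + r) ⟨hball (by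
      rw [Metric.mem_ball, Real.dist_eq, add_sub_cancel_left, abs_of_pos hr]
      linarith), by constructor <;> linarith⟩ (u / r)
      ⟨div_nonneg hu.1 hr.le, (div_le_one hr).2 hu.2⟩
  simp only [smul_eq_mul] at this
  rw [show (1 - u / r) * (1 / 2) + u / r * (1 / 2 + r) = 1 / 2 + u by field_simp; ring] at this
  rw [this, div_eq_mul_inv]
  module

/-- The points of an edge that do not lie on a given open interval, together with all other edges
and all vertices, are mapped to a closed subset of the plane. -/
theorem SpatialGraph.isClosed_image_compl [Finite V] [Finite E] (Γ : SpatialGraph G) (e : E)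
    (a b : ℝ) : IsClosed ((fun x => planeProj (Γ.toFun x)) ''
      ((range fun v => (Quot.mk _ (Sum.inl v) : G.Realization)) ∪
        (⋃ e' ∈ {e' | e' ≠ e}, G.point e' '' Icc 0 1) ∪ G.point e '' (Icc 0 1 \ Ioo a b))) := by
  have hc : ∀ e', ContinuousOn (fun t => planeProj (Γ.toFun (G.point e' t))) (Icc 0 1) :=
    fun e' => continuous_planeProj.comp_continuousOn (Γ.isPLOn e').1
  rw [image_union, image_union, image_iUnion₂]
  refine (IsClosed.union ((finite_range _).image _).isClosed ?_).union ?_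
  · refine (toFinite _).isClosed_biUnion fun e' _ => ?_
    rw [image_image]
    exact (isCompact_Icc.image_of_continuousOn (hc e')).isClosed
  · rw [image_image]
    exact ((isCompact_Icc.diff isOpen_Ioo).image_of_continuousOn
      ((hc e).mono sdiff_subset)).isClosed

theorem SpatialGraph.HasDiagram.exists_straightArc [Finite V] [Finite E] {Γ : SpatialGraph G}
    (h : Γ.HasDiagram) (e : E) : Nonempty (StraightArc Γ e) := by
  obtain ⟨r, ⟨hr0, hr1⟩, d, hd⟩ := Γ.exists_affine e
  have hmem : ∀ u ∈ Ioo 0 r, 1 / 2 + u ∈ Ioo (0 : ℝ) 1 := fun u hu =>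
    ⟨by linarith [hu.1], by linarith [hu.2]⟩
  -- a point of the affine piece that is not at a crossing
  obtain ⟨u₀, hu₀, hX⟩ : ∃ u ∈ Ioo 0 r, ∀ y, G.point e (1 / 2 + u) ≠ y →
      planeProj (Γ.toFun (G.point e (1 / 2 + u))) ≠ planeProj (Γ.toFun y) := by
    have hfin : {u | u ∈ Ioo 0 r ∧ ∃ y, G.point e (1 / 2 + u) ≠ y ∧
        planeProj (Γ.toFun (G.point e (1 / 2 + u))) = planeProj (Γ.toFun y)}.Finite := by
      refine Finite.of_finite_image (f := fun u => G.point e (1 / 2 + u))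
        ((h.finite.image Prod.fst).subset ?_) ?_
      · rintro _ ⟨u, ⟨_, y, hy⟩, rfl⟩
        exact ⟨(_, y), hy, rfl⟩
      · intro u hu u' hu' huu
        have := (point_eq_point_iff (hmem u hu.1) (hmem u' hu'.1)).1 huu
        linarith [this.2]
    obtain ⟨u, hu, hu'⟩ := (Ioo_infinite hr0).exists_notMem_finite hfin
    refine ⟨u, hu, fun y hy hy' => hu' ⟨hu, y, hy, hy'⟩⟩
  set a := 1 / 2 + u₀ with ha
  obtain ⟨η, hη0, hη1, hη2⟩ : ∃ η > 0, η < u₀ ∧ η < r - u₀ :=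
    ⟨min u₀ (r - u₀) / 2, by have := lt_min hu₀.1 (sub_pos.2 hu₀.2); positivity,
      by linarith [min_le_left u₀ (r - u₀), hu₀.1],
      by linarith [min_le_right u₀ (r - u₀), sub_pos.2 hu₀.2]⟩
  have haff : ∀ u, |u| ≤ η →
      Γ.toFun (G.point e (a + u)) = Γ.toFun (G.point e a) + u • d := by
    intro u hu
    have hu := abs_le.1 hu
    rw [ha, add_assoc, hd _ ⟨by linarith, by linarith⟩, hd _ ⟨hu₀.1.le, hu₀.2.le⟩, add_smul,
      add_assoc]
  have hIoo : ∀ u, |u| ≤ η → a + u ∈ Ioo (0 : ℝ) 1 := by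
    intro u hu
    have hu := abs_le.1 hu
    rw [ha, add_assoc]
    exact hmem _ ⟨by linarith, by linarith⟩
  have ha01 : a ∈ Ioo (0 : ℝ) 1 := hmem u₀ hu₀
  have hdpos : 0 < d 0 ^ 2 + d 1 ^ 2 := by
    refine lt_of_le_of_ne (by positivity) fun h0 => ?_
    have h00 : d 0 = 0 := by nlinarith [sq_nonneg (d 0), sq_nonneg (d 1)]
    have h01 : d 1 = 0 := by nlinarith [sq_nonneg (d 0), sq_nonneg (d 1)]
    refine hX (G.point e (a + η)) ?_ ?_
    · rw [Ne, point_eq_point_iff ha01 (hIoo η (abs_of_pos hη0).le)]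
      intro hh
      linarith [hh.2]
    · rw [haff η (abs_of_pos hη0).le]
      ext i
      fin_cases i <;> simp [planeProj, h00, h01]
  -- the rest of the diagram stays at a distance `ρ` from the chosen point
  have hclosed := Γ.isClosed_image_compl e (a - η) (a + η)
  obtain ⟨ρ, hρ, hball⟩ := Metric.isOpen_iff.1 hclosed.isOpen_compl
    (planeProj (Γ.toFun (G.point e a))) (by
      rintro ⟨y, hy, hya⟩
      have hay : G.point e a = y := by
        by_contra hne
        exact hX y hne hya.symm
      rw [← hay] at hy
      rcases hy with (⟨v, hv⟩ | hy) | ⟨t, ht, hta⟩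
      · have := congrArg G.interiorCoord hv
        rw [interiorCoord_point e ha01] at this
        simp [interiorCoord] at this
      · obtain ⟨e', he', t, ht, hta⟩ := mem_iUnion₂.1 hy
        exact he' (eq_of_point_eq_point ht ha01 hta).1
      · rw [(eq_of_point_eq_point ht.1 ha01 hta).2] at ht
        exact ht.2 ⟨by linarith, by linarith⟩)
  set m := |d 0| + |d 1|
  have hm0 : 0 ≤ m := by positivity
  obtain ⟨δ, hδ0, hδη, hδρ⟩ : ∃ δ > 0, 4 * δ ≤ η ∧ 4 * δ * m < ρ := by
    refine ⟨min (η / 4) (ρ / (4 * (m + 1))), by positivity, ?_, ?_⟩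
    · linarith [min_le_left (η / 4) (ρ / (4 * (m + 1)))]
    · have h1 := min_le_right (η / 4) (ρ / (4 * (m + 1)))
      have h2 : 0 < min (η / 4) (ρ / (4 * (m + 1))) := by positivity
      rw [le_div_iff₀ (by positivity)] at h1
      nlinarith
  have hs : ∀ s, |s| < 4 → |s * δ| ≤ η := fun s hs => by
    rw [abs_mul, abs_of_pos hδ0]
    nlinarith
  refine ⟨{ center := a, scale := δ, dir := δ • d, scale_pos := hδ0, dir_pos := ?_,
            mem_Ioo := fun s h4 => hIoo _ (hs s h4),
            affine := fun s h4 => by rw [haff _ (hs s h4), mul_smul],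
            isolated := ?_ }⟩
  · have : (δ • d) 0 ^ 2 + (δ • d) 1 ^ 2 = δ ^ 2 * (d 0 ^ 2 + d 1 ^ 2) := by
      simp only [Pi.smul_apply, smul_eq_mul]
      ring
    rw [this]
    positivity
  · intro x u v hu hv hx
    simp only [Pi.smul_apply, smul_eq_mul] at hx
    have hbound : ∀ p q : ℝ, |p| + |q| = m → |u * (δ * p) - v * (δ * q)| < ρ := by
      intro p q hpq
      refine lt_of_le_of_lt ?_ hδρ
      refine (abs_sub _ _).trans ?_
      rw [abs_mul, abs_mul, abs_mul, abs_mul, abs_of_pos hδ0, ← hpq]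
      nlinarith [mul_nonneg hδ0.le (abs_nonneg p), mul_nonneg hδ0.le (abs_nonneg q)]
    have hxb := hball (show planeProj (Γ.toFun x) ∈ _ by
      rw [Metric.mem_ball, hx, dist_eq_norm, add_sub_cancel_left, pi_norm_lt_iff hρ]
      intro i
      fin_cases i
      · simpa using hbound (d 0) (d 1) rfl
      · simpa using hbound (d 1) (-d 0) (by rw [abs_neg, add_comm]))
    have hxarc : ∃ t, |t| < η ∧ x = G.point e (a + t) := by
      by_contra! hno
      refine hxb ⟨x, ?_, rfl⟩
      rcases exists_eq_vertex_or_point x with ⟨w, hw⟩ | ⟨e', t, ht, hxt⟩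
      · exact Or.inl (Or.inl ⟨w, hw.symm⟩)
      · by_cases he : e' = e
        · subst he
          refine Or.inr ⟨t, ⟨ht, fun hta => ?_⟩, hxt.symm⟩
          exact hno (t - a) (abs_lt.2 ⟨by linarith [hta.1], by linarith [hta.2]⟩)
            (by rw [add_sub_cancel, hxt])
        · exact Or.inl (Or.inr (mem_iUnion₂.2 ⟨e', he, t, ht, hxt.symm⟩))
    obtain ⟨t, ht, hxt⟩ := hxarc
    refine ⟨t / δ, ?_, by rw [div_mul_cancel₀ _ hδ0.ne', hxt]⟩
    -- comparing the coordinates along and across the arc gives `t = u δ`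
    rw [hxt, haff t ht.le] at hx
    have h0 := congrFun hx 0
    have h1 := congrFun hx 1
    simp only [planeProj, Pi.add_apply, Pi.smul_apply, smul_eq_mul, Matrix.cons_val_zero,
      Matrix.cons_val_one, add_right_inj] at h0 h1
    have htu : t = u * δ := by
      have : (t - u * δ) * (d 0 ^ 2 + d 1 ^ 2) = 0 := by linear_combination d 0 * h0 + d 1 * h1
      rcases mul_eq_zero.1 this with h' | h'
      · linarith
      · exact absurd h' hdpos.ne'
    rwa [htu, mul_div_cancel_right₀ _ hδ0.ne']

/-! ### Signs of crossings -/

theorem CounterClockwise.of_det_pos {p q : Plane2} (h : 0 < planeDet p q) {τ : ℝ} (hτ : 0 < τ) :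
    CounterClockwise (τ • p) (τ • q) (-τ • p) ∧ CounterClockwise (-τ • p) (-τ • q) (τ • p) := by
  have h2 : 0 < τ ^ 2 * planeDet p q := by positivity
  refine ⟨Or.inl ⟨?_, ?_⟩, Or.inl ⟨?_, ?_⟩⟩ <;> refine h2.trans_eq ?_ <;>
    simp only [planeDet, Pi.smul_apply, smul_eq_mul] <;> ring

theorem not_counterClockwise_of_det_neg {p q : Plane2} (h : planeDet p q < 0) (τ : ℝ) :
    ¬ CounterClockwise (τ • p) (τ • q) (-τ • p) := by
  have h1 : planeDet (τ • p) (τ • q) = τ ^ 2 * planeDet p q := by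
    simp only [planeDet, Pi.smul_apply, smul_eq_mul]; ring
  have h2 : planeDet (τ • q) (-τ • p) = τ ^ 2 * planeDet p q := by
    simp only [planeDet, Pi.smul_apply, smul_eq_mul]; ring
  have h3 : τ ^ 2 * planeDet p q ≤ 0 := mul_nonpos_of_nonneg_of_nonpos (sq_nonneg τ) h.le
  rw [CounterClockwise, h1, h2]
  rintro (⟨h, _⟩ | ⟨h, _⟩ | ⟨_, h⟩) <;> linarith

section Strands

variable {o u o' u' : ℝ → Plane2} {p q : Plane2}

theorem eventually_neg_of_eventually {Q : ℝ → Prop} (h : ∀ᶠ τ in 𝓝 0, Q τ) :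
    ∀ᶠ τ in 𝓝 (0 : ℝ), Q (-τ) := by
  have : Tendsto (fun τ : ℝ => -τ) (𝓝 0) (𝓝 0) := by simpa using (continuous_neg (G := ℝ)).tendsto 0
  exact this.eventually h

theorem IsPositiveCrossing.congr (h : IsPositiveCrossing o u) (ho : o =ᶠ[𝓝 0] o')
    (hu : u =ᶠ[𝓝 0] u') : IsPositiveCrossing o' u' := by
  filter_upwards [h, nhdsWithin_le_nhds ho, nhdsWithin_le_nhds hu,
    nhdsWithin_le_nhds (eventually_neg_of_eventually ho),
    nhdsWithin_le_nhds (eventually_neg_of_eventually hu)] with τ h h1 h2 h3 h4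
  rwa [← h1, ← h2, ← h3, ← h4]

theorem isPositiveCrossing_congr (ho : o =ᶠ[𝓝 0] o') (hu : u =ᶠ[𝓝 0] u') :
    IsPositiveCrossing o u ↔ IsPositiveCrossing o' u' :=
  ⟨fun h => h.congr ho hu, fun h => h.congr ho.symm hu.symm⟩

theorem isNegativeCrossing_congr (ho : o =ᶠ[𝓝 0] o') (hu : u =ᶠ[𝓝 0] u') :
    IsNegativeCrossing o u ↔ IsNegativeCrossing o' u' :=
  isPositiveCrossing_congr ho (eventually_neg_of_eventually hu)

theorem crossingSign_congr (ho : o =ᶠ[𝓝 0] o') (hu : u =ᶠ[𝓝 0] u') :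
    crossingSign o u = crossingSign o' u' := by
  classical
  rw [crossingSign, crossingSign]
  exact if_congr (isPositiveCrossing_congr ho hu) rfl
    (if_congr (isNegativeCrossing_congr ho hu) rfl rfl)

/-- The sign of a crossing does not change when both strands are reversed. -/
theorem crossingSign_reverse (o u : ℝ → Plane2) :
    crossingSign (fun τ => o (-τ)) (fun τ => u (-τ)) = crossingSign o u := by
  have h : ∀ o u : ℝ → Plane2,
      IsPositiveCrossing (fun τ => o (-τ)) (fun τ => u (-τ)) ↔ IsPositiveCrossing o u := by
    intro o u
    simp only [IsPositiveCrossing, neg_neg, and_comm]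
  classical
  rw [crossingSign, crossingSign]
  exact if_congr (h o u) rfl (if_congr (h o (fun τ => u (-τ))) rfl rfl)

theorem isPositiveCrossing_of_linear (ho : ∀ᶠ τ in 𝓝 0, o τ = τ • p)
    (hu : ∀ᶠ τ in 𝓝 0, u τ = τ • q) (h : 0 < planeDet p q) : IsPositiveCrossing o u := by
  refine IsPositiveCrossing.congr (o := fun τ => τ • p) (u := fun τ => τ • q) ?_
    (ho.mono fun _ => Eq.symm) (hu.mono fun _ => Eq.symm)
  filter_upwards [self_mem_nhdsWithin] with τ hτ
  exact CounterClockwise.of_det_pos h hτ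

theorem isNegativeCrossing_of_linear (ho : ∀ᶠ τ in 𝓝 0, o τ = τ • p)
    (hu : ∀ᶠ τ in 𝓝 0, u τ = τ • q) (h : planeDet p q < 0) : IsNegativeCrossing o u := by
  refine isPositiveCrossing_of_linear (q := -q) ho ?_ ?_
  · filter_upwards [eventually_neg_of_eventually hu] with τ hτ
    rw [hτ, neg_smul, smul_neg]
  · have : planeDet p (-q) = -planeDet p q := by simp only [planeDet, Pi.neg_apply]; ring
    linarith

theorem not_isPositiveCrossing_of_linear (ho : ∀ᶠ τ in 𝓝 0, o τ = τ • p)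
    (hu : ∀ᶠ τ in 𝓝 0, u τ = τ • q) (h : planeDet p q < 0) : ¬ IsPositiveCrossing o u := by
  intro hpos
  obtain ⟨τ, hτ⟩ := Eventually.exists (hpos.congr ho hu)
  exact not_counterClockwise_of_det_neg h τ hτ.1

theorem crossingSign_of_linear (ho : ∀ᶠ τ in 𝓝 0, o τ = τ • p)
    (hu : ∀ᶠ τ in 𝓝 0, u τ = τ • q) (h : planeDet p q ≠ 0) :
    crossingSign o u = SignType.sign (planeDet p q) := by
  rcases lt_or_gt_of_ne h with h | h
  · rw [crossingSign, if_neg (not_isPositiveCrossing_of_linear ho hu h),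
      if_pos (isNegativeCrossing_of_linear ho hu h), sign_neg h]
    rfl
  · rw [crossingSign, if_pos (isPositiveCrossing_of_linear ho hu h), sign_pos h]
    rfl

end Strands

variable {Γ : SpatialGraph G} {e : E}

theorem edgeStrand_neg_one (f : G.Realization → Plane2) (e : E) (a : ℝ) :
    edgeStrand f e a (-1) = fun τ => edgeStrand f e a 1 (-τ) := by
  funext τ
  simp [edgeStrand]

/-! ### Crossings of a cycle -/

theorem EdgeGraph.Traversal.direction_eq (T : G.Traversal) (e : E) :
    T.direction e = 1 ∨ T.direction e = -1 := by
  rw [Traversal.direction]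
  split_ifs <;> simp

theorem GraphDiagram.finite_cycleCrossings (D : GraphDiagram G) (c : G.Cycle) :
    (D.cycleCrossings c).Finite := by
  refine Finite.of_finite_image
    (f := fun p : (E × ℝ) × (E × ℝ) => (G.point p.1.1 p.1.2, G.point p.2.1 p.2.2))
    (D.regular.finite.subset ?_) ?_
  · rintro _ ⟨p, hp, rfl⟩
    exact D.crossing_of_isOver _ _ hp.2.2.2.2
  · rintro ⟨⟨e₁, a₁⟩, ⟨e₂, a₂⟩⟩ ⟨-, h1, -, h2, -⟩ ⟨⟨e₁', a₁'⟩, ⟨e₂', a₂'⟩⟩ ⟨-, h1', -, h2', -⟩ h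
    obtain ⟨hx, hy⟩ := Prod.mk_inj.1 h
    obtain ⟨rfl, rfl⟩ := (point_eq_point_iff h1 h1').1 hx
    obtain ⟨rfl, rfl⟩ := (point_eq_point_iff h2 h2').1 hy
    rfl

/-! ### Moving a spatial graph by an isotopy -/

/-- The image of a spatial graph under the final homeomorphism of an isotopy. -/
def SpatialGraph.move (Γ : SpatialGraph G) (h : PLIsotopy) : SpatialGraph G where
  toFun x := h.toFun 1 (Γ.toFun x)
  isPLOn e := (h.isPLOn_time ⟨zero_le_one, le_rfl⟩).comp (Γ.isPLOn e) (mapsTo_univ _ _)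
  injective := (h.left_inv 1 ⟨zero_le_one, le_rfl⟩).injective.comp Γ.injective

theorem SpatialGraph.isotopic_move (Γ : SpatialGraph G) (h : PLIsotopy) : Γ.Isotopic (Γ.move h) :=
  ⟨h, fun _ => rfl⟩

theorem SpatialGraph.Isotopic.trans {Γ₁ Γ₂ Γ₃ : SpatialGraph G} (h : Γ₁.Isotopic Γ₂)
    (h' : Γ₂.Isotopic Γ₃) : Γ₁.Isotopic Γ₃ := by
  obtain ⟨φ, hφ⟩ := h
  obtain ⟨ψ, hψ⟩ := h'
  exact ⟨φ.trans ψ, fun x => by simp only [PLIsotopy.trans, hφ, hψ]⟩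

namespace StraightArc

variable (A : StraightArc Γ e) {σ : ℝ} (hσ : σ * σ = 1)

/-! ### The graph with a kink in a straight arc -/

/-- The point with parameter `s` on the straight arc. -/
def pt (s : ℝ) : G.Realization := G.point e (A.center + s * A.scale)

/-- The set of the points of the straight arc. -/
def arc : Set G.Realization := {x | ∃ s, |s| < 4 ∧ x = A.pt s}

/-- The coordinates of a point of `Γ` in the chart of the straight arc. -/
def coord (x : G.Realization) : Space3 :=
  (kinkChart A.dir A.dir_pos σ hσ).symm (Γ.toFun x - Γ.toFun (G.point e A.center))

/-- The inverse of the chart of the straight arc. -/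
def chart (y : Space3) : Space3 :=
  Γ.toFun (G.point e A.center) + kinkChart A.dir A.dir_pos σ hσ y

/-- The spatial graph obtained from `Γ` by adding a kink in the straight arc. The sign `σ`
determines which of the two strands is on top. -/
def kinked : SpatialGraph G :=
  Γ.move (kinkIsotopy.conj (kinkChart A.dir A.dir_pos σ hσ) (Γ.toFun (G.point e A.center)))

theorem chart_coord (x : G.Realization) : A.chart hσ (A.coord hσ x) = Γ.toFun x := by
  simp [chart, coord]

theorem kinked_apply (x : G.Realization) :
    (A.kinked hσ).toFun x = A.chart hσ (kinkIsotopy.toFun 1 (A.coord hσ x)) := rfl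

theorem chart_apply_two (y : Space3) :
    A.chart hσ y 2 = Γ.toFun (G.point e A.center) 2 + (y 0 * A.dir 2 + σ * y 2) := rfl

theorem planeProj_chart (y : Space3) : planeProj (A.chart hσ y) =
    planeProj (Γ.toFun (G.point e A.center)) +
      ![y 0 * A.dir 0 - y 1 * A.dir 1, y 0 * A.dir 1 + y 1 * A.dir 0] := by
  ext i
  fin_cases i <;> rfl

theorem planeProj_chart_eq_iff (y y' : Space3) :
    planeProj (A.chart hσ y) = planeProj (A.chart hσ y') ↔ y 0 = y' 0 ∧ y 1 = y' 1 := by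
  rw [planeProj_chart, planeProj_chart, add_right_inj]
  refine ⟨fun h => ?_, fun ⟨h0, h1⟩ => by rw [h0, h1]⟩
  have h0 := congrFun h 0
  have h1 := congrFun h 1
  simp only [Matrix.cons_val_zero, Matrix.cons_val_one] at h0 h1
  have hd := A.dir_pos.ne'
  refine ⟨mul_right_cancel₀ hd ?_, mul_right_cancel₀ hd ?_⟩
  · linear_combination A.dir 0 * h0 + A.dir 1 * h1
  · linear_combination A.dir 0 * h1 - A.dir 1 * h0

theorem coord_pt {s : ℝ} (hs : |s| < 4) : A.coord hσ (A.pt s) = ![s, 0, 0] := by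
  rw [coord, LinearEquiv.symm_apply_eq, pt, A.affine s hs, kinkChart_apply]
  ext i
  fin_cases i <;> simp

theorem le_abs_coord {x : G.Realization} (hx : x ∉ A.arc) :
    4 ≤ |A.coord hσ x 0| ∨ 4 ≤ |A.coord hσ x 1| := by
  by_contra! h
  refine hx (A.isolated x _ _ h.1 h.2 ?_)
  rw [← A.chart_coord hσ x, planeProj_chart]

theorem kinked_of_le_abs_coord {x : G.Realization}
    (h : 3 ≤ |A.coord hσ x 0| ∨ 3 ≤ |A.coord hσ x 1|) : (A.kinked hσ).toFun x = Γ.toFun x := by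
  rw [kinked_apply, kinkIsotopy_of_outside h, chart_coord]

theorem kinked_of_notMem {x : G.Realization} (hx : x ∉ A.arc) :
    (A.kinked hσ).toFun x = Γ.toFun x :=
  A.kinked_of_le_abs_coord hσ ((A.le_abs_coord hσ hx).imp
    (fun h => by linarith) (fun h => by linarith))

theorem kinked_pt {s : ℝ} (hs : |s| < 4) :
    (A.kinked hσ).toFun (A.pt s) = A.chart hσ (kinkCurve s) := by
  rw [kinked_apply, coord_pt A hσ hs, kinkIsotopy_axis]

/-- The projection of a point outside the arc is not in the square of the kink. -/
theorem planeProj_ne_of_notMem {x : G.Realization} (hx : x ∉ A.arc) {y : Space3} (h0 : |y 0| < 4)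
    (h1 : |y 1| < 4) : planeProj (Γ.toFun x) ≠ planeProj (A.chart hσ y) := by
  rw [← A.chart_coord hσ x, Ne, planeProj_chart_eq_iff]
  rintro ⟨h0', h1'⟩
  rcases A.le_abs_coord hσ hx with h | h
  · rw [h0'] at h; linarith
  · rw [h1'] at h; linarith

theorem notMem_arc_of_double_point {x y : G.Realization} (hne : x ≠ y)
    (h : planeProj (Γ.toFun x) = planeProj (Γ.toFun y)) : y ∉ A.arc := by
  rintro ⟨s, hs, rfl⟩
  have hσ : (1 : ℝ) * 1 = 1 := mul_one 1
  have hy := A.coord_pt hσ hs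
  rw [← A.chart_coord hσ (A.pt s), hy] at h
  by_cases hx : x ∈ A.arc
  · obtain ⟨s', hs', rfl⟩ := hx
    rw [← A.chart_coord hσ (A.pt s'), A.coord_pt hσ hs', planeProj_chart_eq_iff] at h
    exact hne (congrArg A.pt h.1)
  · exact A.planeProj_ne_of_notMem hσ hx (by simpa using hs) (by simp) h

theorem kinkCurve_double (hσ : σ * σ = 1) :
    kinkCurve (σ * (2 / 3)) = ![0, 1 / 3, -(σ * (2 / 3))] := by
  simpa using kinkCurve_near_double_point (τ := 0) (mul_self_eq_one_iff.1 hσ) (by norm_num)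

theorem kinkCurve_double_neg (hσ : σ * σ = 1) :
    kinkCurve (-(σ * (2 / 3))) = ![0, 1 / 3, σ * (2 / 3)] := by
  simpa using kinkCurve_double (σ := -σ) (by simpa using hσ)

theorem abs_double_lt (hσ : σ * σ = 1) : |σ * (2 / 3)| < 4 := by
  rcases mul_self_eq_one_iff.1 hσ with rfl | rfl <;> norm_num [abs_lt]

/-- The upper point of the crossing of the kink. -/
def overPt : G.Realization := A.pt (-(σ * (2 / 3)))

/-- The lower point of the crossing of the kink. -/
def underPt : G.Realization := A.pt (σ * (2 / 3))

theorem pt_inj {s s' : ℝ} (hs : |s| < 4) (hs' : |s'| < 4) : A.pt s = A.pt s' ↔ s = s' := by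
  refine ⟨fun h => ?_, fun h => by rw [h]⟩
  have := ((point_eq_point_iff (A.mem_Ioo s hs) (A.mem_Ioo s' hs')).1 h).2
  exact mul_right_cancel₀ A.scale_pos.ne' (add_left_cancel this)

theorem overPt_ne_underPt (hσ : σ * σ = 1) : A.overPt (σ := σ) ≠ A.underPt (σ := σ) := by
  have h := abs_double_lt hσ
  rw [overPt, underPt, Ne, A.pt_inj (by rwa [abs_neg]) h]
  intro h'
  rcases mul_self_eq_one_iff.1 hσ with rfl | rfl <;> norm_num at h'

theorem overPt_mem_arc (hσ : σ * σ = 1) : A.overPt (σ := σ) ∈ A.arc :=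
  ⟨_, by rw [abs_neg]; exact abs_double_lt hσ, rfl⟩

theorem underPt_mem_arc (hσ : σ * σ = 1) : A.underPt (σ := σ) ∈ A.arc :=
  ⟨_, abs_double_lt hσ, rfl⟩

theorem kinked_overPt : (A.kinked hσ).toFun (A.overPt (σ := σ)) =
    A.chart hσ ![0, 1 / 3, σ * (2 / 3)] := by
  rw [overPt, kinked_pt, kinkCurve_double_neg hσ]
  rw [abs_neg]
  exact abs_double_lt hσ

theorem kinked_underPt : (A.kinked hσ).toFun (A.underPt (σ := σ)) =
    A.chart hσ ![0, 1 / 3, -(σ * (2 / 3))] := by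
  rw [underPt, kinked_pt _ _ (abs_double_lt hσ), kinkCurve_double hσ]

theorem planeProj_kinked_overPt : planeProj ((A.kinked hσ).toFun (A.overPt (σ := σ))) =
    planeProj ((A.kinked hσ).toFun (A.underPt (σ := σ))) := by
  rw [kinked_overPt, kinked_underPt, planeProj_chart_eq_iff]
  exact ⟨rfl, rfl⟩

theorem kinked_underPt_lt_overPt : (A.kinked hσ).toFun (A.underPt (σ := σ)) 2 <
    (A.kinked hσ).toFun (A.overPt (σ := σ)) 2 := by
  rw [kinked_overPt, kinked_underPt, chart_apply_two, chart_apply_two]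
  simp only [Matrix.cons_val]
  linarith [hσ]

/-- The double points of the projection of the graph with a kink are those of the old projection
and the crossing of the kink. -/
theorem double_point_kinked_iff (x y : G.Realization) :
    (x ≠ y ∧ planeProj ((A.kinked hσ).toFun x) = planeProj ((A.kinked hσ).toFun y)) ↔
      (x ≠ y ∧ planeProj (Γ.toFun x) = planeProj (Γ.toFun y)) ∨
      (x = A.overPt (σ := σ) ∧ y = A.underPt (σ := σ)) ∨
      (x = A.underPt (σ := σ) ∧ y = A.overPt (σ := σ)) := by
  constructor
  · rintro ⟨hne, h⟩
    by_cases hx : x ∈ A.arc <;> by_cases hy : y ∈ A.arc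
    · right
      obtain ⟨s, hs, rfl⟩ := hx
      obtain ⟨s', hs', rfl⟩ := hy
      rw [A.kinked_pt hσ hs, A.kinked_pt hσ hs', planeProj_chart_eq_iff] at h
      have hd := kinkCurve_double_point (fun hss => hne (by rw [hss])) h.1 h.2
      rcases mul_self_eq_one_iff.1 hσ with rfl | rfl <;>
      rcases hd with ⟨rfl, rfl⟩ | ⟨rfl, rfl⟩ <;> simp [overPt, underPt]
    · obtain ⟨s, hs, rfl⟩ := hx
      rw [A.kinked_pt hσ hs, A.kinked_of_notMem hσ hy] at h
      exact absurd h.symm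
        (A.planeProj_ne_of_notMem hσ hy (abs_kinkCurve_lt hs).1 (abs_kinkCurve_lt hs).2)
    · obtain ⟨s, hs, rfl⟩ := hy
      rw [A.kinked_pt hσ hs, A.kinked_of_notMem hσ hx] at h
      exact absurd h
        (A.planeProj_ne_of_notMem hσ hx (abs_kinkCurve_lt hs).1 (abs_kinkCurve_lt hs).2)
    · rw [A.kinked_of_notMem hσ hx, A.kinked_of_notMem hσ hy] at h
      exact Or.inl ⟨hne, h⟩
  · rintro (⟨hne, h⟩ | ⟨rfl, rfl⟩ | ⟨rfl, rfl⟩)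
    · rw [A.kinked_of_notMem hσ (A.notMem_arc_of_double_point hne h),
        A.kinked_of_notMem hσ (A.notMem_arc_of_double_point hne.symm h.symm)]
      exact ⟨hne, h⟩
    · exact ⟨A.overPt_ne_underPt hσ, A.planeProj_kinked_overPt hσ⟩
    · exact ⟨(A.overPt_ne_underPt hσ).symm, (A.planeProj_kinked_overPt hσ).symm⟩

/-! ### Strands of the graph with a kink -/

/-- Near an interior point of an edge that is not on the arc, the kink does not change the
projection. -/
theorem edgeStrand_kinked_eventuallyEq {e' : E} {a : ℝ} (ha : a ∈ Ioo (0 : ℝ) 1)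
    (hx : G.point e' a ∉ A.arc) (ε : ℝ) :
    edgeStrand (fun x => planeProj ((A.kinked hσ).toFun x)) e' a ε =ᶠ[𝓝 0]
      edgeStrand (fun x => planeProj (Γ.toFun x)) e' a ε := by
  have htend : Tendsto (fun τ : ℝ => a + ε * τ) (𝓝 0) (𝓝 a) := by
    have : Continuous (fun τ : ℝ => a + ε * τ) := by fun_prop
    simpa using this.tendsto 0
  have hΓ : ContinuousAt (fun t => Γ.toFun (G.point e' t)) a :=
    (Γ.isPLOn e').1.continuousAt (Icc_mem_nhds ha.1 ha.2)
  have hcoord : ContinuousAt (fun t => A.coord hσ (G.point e' t)) a :=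
    (kinkChart A.dir A.dir_pos σ hσ).symm.toContinuousLinearEquiv.continuous.continuousAt.comp
      (hΓ.sub continuousAt_const)
  have hev : ∀ᶠ t in 𝓝 a, 3 ≤ |A.coord hσ (G.point e' t) 0| ∨
      3 ≤ |A.coord hσ (G.point e' t) 1| := by
    have hi : ∀ i : Fin 3, ContinuousAt (fun t => |A.coord hσ (G.point e' t) i|) a :=
      fun i => (continuousAt_pi.1 hcoord i).abs
    rcases A.le_abs_coord hσ hx with h | h
    · filter_upwards [(hi 0).eventually (lt_mem_nhds (show (3 : ℝ) < _ by linarith))] with t ht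
      exact Or.inl ht.le
    · filter_upwards [(hi 1).eventually (lt_mem_nhds (show (3 : ℝ) < _ by linarith))] with t ht
      exact Or.inr ht.le
  filter_upwards [htend.eventually hev] with τ hτ
  simp only [edgeStrand, A.kinked_of_le_abs_coord hσ hτ, A.kinked_of_notMem hσ hx]

/-- The velocity of the strand of the kink through the parameter `ν * (2 / 3)`, for `ν = ± 1`. -/
def velocity (ν : ℝ) : Plane2 :=
  A.scale⁻¹ • ![3 * A.dir 0 + ν * A.dir 1, 3 * A.dir 1 - ν * A.dir 0]

theorem edgeStrand_kinked_arc {ν : ℝ} (hν : ν = 1 ∨ ν = -1) :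
    ∀ᶠ τ in 𝓝 (0 : ℝ), edgeStrand (fun x => planeProj ((A.kinked hσ).toFun x)) e
      (A.center + ν * (2 / 3) * A.scale) 1 τ = τ • A.velocity ν := by
  have hδ := A.scale_pos
  have hsmall : ∀ᶠ τ in 𝓝 (0 : ℝ), |τ / A.scale| < 1 / 6 := by
    have : Continuous (fun τ : ℝ => |τ / A.scale|) := by fun_prop
    exact this.continuousAt.eventually (gt_mem_nhds (by simp))
  filter_upwards [hsmall] with τ hτ
  have hlt : ∀ τ : ℝ, |τ| < 1 / 6 → |ν * (2 / 3) + τ| < 4 := by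
    intro τ h
    have h := abs_lt.1 h
    rw [abs_lt]
    rcases hν with rfl | rfl <;> constructor <;> linarith
  have hpar : A.center + ν * (2 / 3) * A.scale + 1 * τ =
      A.center + (ν * (2 / 3) + τ / A.scale) * A.scale := by
    field_simp
    ring
  have h1 := A.kinked_pt hσ (hlt _ hτ)
  have h0 := A.kinked_pt hσ (hlt 0 (by norm_num))
  rw [kinkCurve_near_double_point hν hτ.le] at h1
  rw [kinkCurve_near_double_point hν (by norm_num), add_zero] at h0
  rw [edgeStrand, hpar]
  change planeProj ((A.kinked hσ).toFun (A.pt _)) - planeProj ((A.kinked hσ).toFun (A.pt _)) = _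
  rw [h1, h0, planeProj_chart, planeProj_chart, add_sub_add_left_eq_sub]
  ext i
  fin_cases i <;> simp [velocity] <;> field_simp <;> ring

theorem planeDet_velocity (ν : ℝ) : planeDet (A.velocity ν) (A.velocity (-ν)) =
    ν * (6 * A.scale⁻¹ ^ 2 * (A.dir 0 ^ 2 + A.dir 1 ^ 2)) := by
  simp [planeDet, velocity]
  ring

theorem planeDet_velocity_ne_zero {ν : ℝ} (hν : ν = 1 ∨ ν = -1) :
    planeDet (A.velocity ν) (A.velocity (-ν)) ≠ 0 := by
  have := A.scale_pos
  have := A.dir_pos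
  rw [planeDet_velocity]
  refine mul_ne_zero ?_ (by positivity)
  rcases hν with rfl | rfl <;> norm_num

theorem isPositiveCrossing_or_isNegativeCrossing_kinked {ν : ℝ} (hν : ν = 1 ∨ ν = -1) :
    IsPositiveCrossing
      (edgeStrand (fun x => planeProj ((A.kinked hσ).toFun x)) e
        (A.center + ν * (2 / 3) * A.scale) 1)
      (edgeStrand (fun x => planeProj ((A.kinked hσ).toFun x)) e
        (A.center + -ν * (2 / 3) * A.scale) 1) ∨
    IsNegativeCrossing
      (edgeStrand (fun x => planeProj ((A.kinked hσ).toFun x)) e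
        (A.center + ν * (2 / 3) * A.scale) 1)
      (edgeStrand (fun x => planeProj ((A.kinked hσ).toFun x)) e
        (A.center + -ν * (2 / 3) * A.scale) 1) := by
  have ho := A.edgeStrand_kinked_arc hσ hν
  have hu := A.edgeStrand_kinked_arc hσ (ν := -ν) (by rcases hν with rfl | rfl <;> simp)
  rcases lt_or_gt_of_ne (A.planeDet_velocity_ne_zero hν) with h | h
  · exact Or.inr (isNegativeCrossing_of_linear ho hu h)
  · exact Or.inl (isPositiveCrossing_of_linear ho hu h)

theorem eq_of_point_eq_pt {e' : E} {a s : ℝ} (ha : a ∈ Ioo (0 : ℝ) 1) (hs : |s| < 4)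
    (h : G.point e' a = A.pt s) : e' = e ∧ a = A.center + s * A.scale :=
  (point_eq_point_iff ha (A.mem_Ioo s hs)).1 h

theorem hasDiagram_kinked (hΓ : Γ.HasDiagram) : (A.kinked hσ).HasDiagram where
  finite := by
    refine (hΓ.finite.union (toFinite {(A.overPt (σ := σ), A.underPt (σ := σ)),
      (A.underPt (σ := σ), A.overPt (σ := σ))})).subset ?_
    rintro ⟨x, y⟩ h
    rcases (A.double_point_kinked_iff hσ x y).1 h with h | ⟨rfl, rfl⟩ | ⟨rfl, rfl⟩
    · exact Or.inl h
    · exact Or.inr (Or.inl rfl)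
    · exact Or.inr (Or.inr rfl)
  interior x y hne h := by
    have hs := abs_double_lt hσ
    rcases (A.double_point_kinked_iff hσ x y).1 ⟨hne, h⟩ with h | ⟨rfl, rfl⟩ | ⟨rfl, rfl⟩
    · exact hΓ.interior x y h.1 h.2
    · exact ⟨e, _, A.mem_Ioo _ (by rwa [abs_neg]), rfl⟩
    · exact ⟨e, _, A.mem_Ioo _ hs, rfl⟩
  double x y z hxy hyz := by
    have ho := A.overPt_mem_arc hσ
    have hu := A.underPt_mem_arc hσ
    by_contra! hne
    obtain ⟨h1, h2, h3⟩ := hne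
    have old : ∀ {x y : G.Realization}, x ≠ y →
        planeProj (Γ.toFun x) = planeProj (Γ.toFun y) → x ∉ A.arc ∧ y ∉ A.arc :=
      fun hne h => ⟨A.notMem_arc_of_double_point hne.symm h.symm,
        A.notMem_arc_of_double_point hne h⟩
    rcases (A.double_point_kinked_iff hσ x y).1 ⟨h1, hxy⟩ with h | ⟨rfl, rfl⟩ | ⟨rfl, rfl⟩ <;>
    rcases (A.double_point_kinked_iff hσ _ z).1 ⟨h2, hyz⟩ with h' | ⟨h', rfl⟩ | ⟨h', rfl⟩
    · rcases hΓ.double x y z h.2 h'.2 with h | h | h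
      exacts [h1 h, h2 h, h3 h]
    · exact (old h.1 h.2).2 (h' ▸ ho)
    · exact (old h.1 h.2).2 (h' ▸ hu)
    · exact (old h'.1 h'.2).1 hu
    · exact h1 h'.symm
    · exact h3 rfl
    · exact (old h'.1 h'.2).1 ho
    · exact h3 rfl
    · exact h1 h'.symm
  transverse e₁ a₁ ha₁ e₂ a₂ ha₂ hne h := by
    have hs := abs_double_lt hσ
    have hν := mul_self_eq_one_iff.1 hσ
    rcases (A.double_point_kinked_iff hσ _ _).1 ⟨hne, h⟩ with h | ⟨h1, h2⟩ | ⟨h1, h2⟩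
    · have h1 := A.edgeStrand_kinked_eventuallyEq hσ ha₁
        (A.notMem_arc_of_double_point h.1.symm h.2.symm) 1
      have h2 := A.edgeStrand_kinked_eventuallyEq hσ ha₂ (A.notMem_arc_of_double_point h.1 h.2) 1
      rw [isPositiveCrossing_congr h1 h2, isNegativeCrossing_congr h1 h2]
      exact hΓ.transverse e₁ a₁ ha₁ e₂ a₂ ha₂ h.1 h.2
    · obtain ⟨rfl, rfl⟩ := A.eq_of_point_eq_pt ha₁ (by rwa [abs_neg]) h1
      obtain ⟨rfl, rfl⟩ := A.eq_of_point_eq_pt ha₂ hs h2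
      have := A.isPositiveCrossing_or_isNegativeCrossing_kinked hσ (ν := -σ)
        (by rcases hν with rfl | rfl <;> simp)
      rwa [neg_neg, neg_mul] at this
    · obtain ⟨rfl, rfl⟩ := A.eq_of_point_eq_pt ha₁ hs h1
      obtain ⟨rfl, rfl⟩ := A.eq_of_point_eq_pt ha₂ (by rwa [abs_neg]) h2
      have := A.isPositiveCrossing_or_isNegativeCrossing_kinked hσ hν
      rwa [neg_mul] at this

/-! ### The effect of a kink on writhes -/

/-- The crossing of the kink, as a crossing of a diagram. -/
def crossing (σ : ℝ) : (E × ℝ) × (E × ℝ) :=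
  ((e, A.center + -(σ * (2 / 3)) * A.scale), (e, A.center + σ * (2 / 3) * A.scale))

open Classical in
theorem cycleCrossings_kinked (hΓ : Γ.HasDiagram) (c : G.Cycle) :
    ((A.kinked hσ).diagram (A.hasDiagram_kinked hσ hΓ)).cycleCrossings c =
      if e ∈ c.edges then insert (A.crossing σ) ((Γ.diagram hΓ).cycleCrossings c)
      else (Γ.diagram hΓ).cycleCrossings c := by
  have hs := abs_double_lt hσ
  have hover : ∀ x y, ((A.kinked hσ).diagram (A.hasDiagram_kinked hσ hΓ)).isOver x y ↔
      (Γ.diagram hΓ).isOver x y ∨ (x = A.overPt (σ := σ) ∧ y = A.underPt (σ := σ)) := by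
    intro x y
    simp only [SpatialGraph.diagram]
    constructor
    · rintro ⟨h, hlt⟩
      have hne : x ≠ y := fun h => by simp [h] at hlt
      rcases (A.double_point_kinked_iff hσ x y).1 ⟨hne, h⟩ with h | h | ⟨rfl, rfl⟩
      · rw [A.kinked_of_notMem hσ (A.notMem_arc_of_double_point h.1 h.2),
          A.kinked_of_notMem hσ (A.notMem_arc_of_double_point h.1.symm h.2.symm)] at hlt
        exact Or.inl ⟨h.2, hlt⟩
      · exact Or.inr h
      · exact absurd hlt (A.kinked_underPt_lt_overPt hσ).not_gt
    · rintro (⟨h, hlt⟩ | ⟨rfl, rfl⟩)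
      · have hne : x ≠ y := fun h => by simp [h] at hlt
        rw [A.kinked_of_notMem hσ (A.notMem_arc_of_double_point hne h),
          A.kinked_of_notMem hσ (A.notMem_arc_of_double_point hne.symm h.symm)]
        exact ⟨h, hlt⟩
      · exact ⟨A.planeProj_kinked_overPt hσ, A.kinked_underPt_lt_overPt hσ⟩
  ext ⟨⟨e₁, a₁⟩, ⟨e₂, a₂⟩⟩
  by_cases hc : e ∈ c.edges
  · rw [if_pos hc, mem_insert_iff]
    simp only [GraphDiagram.cycleCrossings, mem_ofPred_eq, hover]
    constructor
    · rintro ⟨h1, ha1, h2, ha2, h | ⟨hx, hy⟩⟩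
      · exact Or.inr ⟨h1, ha1, h2, ha2, h⟩
      · obtain ⟨rfl, rfl⟩ := A.eq_of_point_eq_pt ha1 (by rwa [abs_neg]) hx
        obtain ⟨rfl, rfl⟩ := A.eq_of_point_eq_pt ha2 hs hy
        exact Or.inl rfl
    · rintro (h | ⟨h1, ha1, h2, ha2, h⟩)
      · simp only [crossing, Prod.mk_inj] at h
        obtain ⟨⟨rfl, rfl⟩, rfl, rfl⟩ := h
        exact ⟨hc, A.mem_Ioo _ (by rwa [abs_neg]), hc, A.mem_Ioo _ hs, Or.inr ⟨rfl, rfl⟩⟩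
      · exact ⟨h1, ha1, h2, ha2, Or.inl h⟩
  · rw [if_neg hc]
    simp only [GraphDiagram.cycleCrossings, mem_ofPred_eq, hover]
    constructor
    · rintro ⟨h1, ha1, h2, ha2, h | ⟨hx, hy⟩⟩
      · exact ⟨h1, ha1, h2, ha2, h⟩
      · obtain ⟨rfl, rfl⟩ := A.eq_of_point_eq_pt ha2 hs hy
        exact absurd h2 hc
    · rintro ⟨h1, ha1, h2, ha2, h⟩
      exact ⟨h1, ha1, h2, ha2, Or.inl h⟩

/-- The sign of the crossing of the kink does not depend on the direction in which the edge is
traversed. -/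
theorem crossingSign_kinked {ε : ℝ} (hε : ε = 1 ∨ ε = -1) :
    crossingSign
      (edgeStrand (fun x => planeProj ((A.kinked hσ).toFun x)) e
        (A.center + -(σ * (2 / 3)) * A.scale) ε)
      (edgeStrand (fun x => planeProj ((A.kinked hσ).toFun x)) e
        (A.center + σ * (2 / 3) * A.scale) ε) = SignType.sign (-σ) := by
  have hν : -σ = 1 ∨ -σ = -1 := by
    rcases mul_self_eq_one_iff.1 hσ with rfl | rfl <;> simp
  have ho := A.edgeStrand_kinked_arc hσ hν
  have hu := A.edgeStrand_kinked_arc hσ (mul_self_eq_one_iff.1 hσ)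
  have hdet := A.planeDet_velocity_ne_zero hν
  have hval := A.planeDet_velocity (-σ)
  rw [neg_neg] at hdet hval
  rw [neg_mul] at ho
  have hpos : 0 < 6 * A.scale⁻¹ ^ 2 * (A.dir 0 ^ 2 + A.dir 1 ^ 2) := by
    have := A.scale_pos
    have := A.dir_pos
    positivity
  have key := crossingSign_of_linear ho hu hdet
  rw [hval, sign_mul, sign_pos hpos, mul_one] at key
  rcases hε with rfl | rfl
  · exact key
  · rw [edgeStrand_neg_one, edgeStrand_neg_one, crossingSign_reverse, key]

open Classical in
theorem writhe_kinked (hΓ : Γ.HasDiagram) (c : G.Cycle) :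
    ((A.kinked hσ).diagram (A.hasDiagram_kinked hσ hΓ)).writhe c =
      (Γ.diagram hΓ).writhe c + if e ∈ c.edges then (SignType.sign (-σ) : ℤ) else 0 := by
  -- the old crossings keep their signs
  have hold : ∀ p ∈ (Γ.diagram hΓ).cycleCrossings c,
      crossingSign
        (edgeStrand (fun x => planeProj ((A.kinked hσ).toFun x)) p.1.1 p.1.2
          (c.traversal.direction p.1.1))
        (edgeStrand (fun x => planeProj ((A.kinked hσ).toFun x)) p.2.1 p.2.2
          (c.traversal.direction p.2.1)) =
      crossingSign
        (edgeStrand (fun x => planeProj (Γ.toFun x)) p.1.1 p.1.2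
          (c.traversal.direction p.1.1))
        (edgeStrand (fun x => planeProj (Γ.toFun x)) p.2.1 p.2.2
          (c.traversal.direction p.2.1)) := by
    rintro p ⟨-, h1, -, h2, h⟩
    obtain ⟨hne, heq⟩ := (Γ.diagram hΓ).crossing_of_isOver _ _ h
    exact crossingSign_congr
      (A.edgeStrand_kinked_eventuallyEq hσ h1
        (A.notMem_arc_of_double_point hne.symm heq.symm) _)
      (A.edgeStrand_kinked_eventuallyEq hσ h2 (A.notMem_arc_of_double_point hne heq) _)
  rw [GraphDiagram.writhe, GraphDiagram.writhe, A.cycleCrossings_kinked hσ hΓ c]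
  by_cases hc : e ∈ c.edges
  · have hnew : A.crossing σ ∉ (Γ.diagram hΓ).cycleCrossings c := by
      rintro ⟨-, -, -, -, h⟩
      obtain ⟨hne, heq⟩ := (Γ.diagram hΓ).crossing_of_isOver _ _ h
      exact A.notMem_arc_of_double_point hne heq (A.underPt_mem_arc hσ)
    rw [if_pos hc, if_pos hc, finsum_mem_insert _ hnew (GraphDiagram.finite_cycleCrossings _ c),
      add_comm]
    exact congrArg₂ (· + ·) (finsum_mem_congr rfl hold)
      (A.crossingSign_kinked hσ (c.traversal.direction_eq e))
  · rw [if_neg hc, if_neg hc, add_zero]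
    exact finsum_mem_congr rfl hold

end StraightArc

/-! ### Realizing tuples of writhes -/

/-- The edge `e` can be given a kink of either sign, which adds this sign to the writhe of each
cycle that contains `e`. -/
theorem GraphDiagram.IsDiagramOf.exists_kink [Finite V] [Fintype E] [DecidableEq E]
    {D : GraphDiagram G} (hD : D.IsDiagramOf Γ) (C : Set G.Cycle) (e : E) {ε : ℤ}
    (hε : ε = 1 ∨ ε = -1) :
    ∃ D' : GraphDiagram G, D'.IsDiagramOf Γ ∧
      D'.writheTuple C = D.writheTuple C + G.cycleMap C (ε • Pi.single e 1) := by
  obtain ⟨Γ', hiso, hΓ', rfl⟩ := hD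
  obtain ⟨A⟩ := hΓ'.exists_straightArc e
  -- the crossing of the kink made in the chart of sign `σ` has sign `-σ`
  have hσ : (-(ε : ℝ)) * (-(ε : ℝ)) = 1 := by rcases hε with rfl | rfl <;> simp
  refine ⟨_, ⟨A.kinked hσ, hiso.trans (Γ'.isotopic_move _), A.hasDiagram_kinked hσ hΓ', rfl⟩, ?_⟩
  funext c
  rw [Pi.add_apply, GraphDiagram.writheTuple, A.writhe_kinked hσ hΓ' c.1, GraphDiagram.writheTuple]
  congr 1
  rw [map_smul, EdgeGraph.cycleMap, Fintype.linearCombination_apply_single, neg_neg]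
  rcases hε with rfl | rfl <;> simp

end

theorem corollary3p3 {V E : Type*} [Finite V] [Fintype E] (G : EdgeGraph V E)
    (Γ : SpatialGraph G) (D : GraphDiagram G) (hD : D.IsDiagramOf Γ) (C : Set G.Cycle)
    (w : C → ℤ) (hw : w - D.writheTuple C ∈ LinearMap.range (G.cycleMap C)) :
    ∃ D' : GraphDiagram G, D'.IsDiagramOf Γ ∧ D'.writheTuple C = w := by
  classical
  -- the vectors that can be added to the tuple of any diagram of `Γ`, and subtracted from it
  let S : AddSubgroup (E → ℤ) :=
    { carrier := {n | ∀ ε : ℤ, ε = 1 ∨ ε = -1 → ∀ D : GraphDiagram G, D.IsDiagramOf Γ →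
        ∃ D' : GraphDiagram G, D'.IsDiagramOf Γ ∧
          D'.writheTuple C = D.writheTuple C + G.cycleMap C (ε • n)}
      zero_mem' := fun ε _ D hD => ⟨D, hD, by simp⟩
      add_mem' := fun {m n} hm hn ε hε D hD => by
        obtain ⟨D₁, hD₁, h₁⟩ := hm ε hε D hD
        obtain ⟨D₂, hD₂, h₂⟩ := hn ε hε D₁ hD₁
        exact ⟨D₂, hD₂, by rw [h₂, h₁, smul_add, map_add, add_assoc]⟩
      neg_mem' := fun {n} hn ε hε D hD => by
        obtain ⟨D', hD', h⟩ := hn (-ε) (by rcases hε with rfl | rfl <;> simp) D hD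
        exact ⟨D', hD', by rw [h, neg_smul, smul_neg]⟩ }
  have hS : ∀ n : E → ℤ, n ∈ S := by
    intro n
    rw [← Finset.univ_sum_single n]
    refine S.sum_mem fun e _ => ?_
    have : (Pi.single e (n e) : E → ℤ) = n e • Pi.single e 1 := by
      rw [← Pi.single_smul, smul_eq_mul, mul_one]
    rw [this]
    exact S.zsmul_mem (fun ε hε D hD => hD.exists_kink C e hε) (n e)
  obtain ⟨n, hn⟩ := hw
  obtain ⟨D', hD', h⟩ := hS n 1 (Or.inl rfl) D hD
  exact ⟨D', hD', by rw [h, one_smul, hn, add_sub_cancel]⟩
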